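/- \textbf{Theorem.} For $f\colon\mathbb{R}\to\mathbb{R}$ and $\alpha,h\in\mathbb{R}$ put $\delta_\alpha f(x)=f(\alpha x)-\alpha f(x)$ and $\Delta_h f(x)=f(x+h)-f(x)$ $(x\in\mathbb{R})$. For an integer $n\ge 1$, a \emph{derivation of order $n$} is an additive function $d\colon\mathbb{R}\to\mathbb{R}$ with $d(1)=0$ and $\delta_{\alpha_1}\circ\cdots\circ\delta_{\alpha_{n+1}}d(x)=0$ for all $\alpha_1,\dots,\alpha_{n+1},x\in\mathbb{R}$; and $\mathbf{D}f\colon\mathbb{R}\to\mathbb{R}$ denotes the function $(\mathbf{D}f)(\alpha)=\delta_\alpha^{n+1}f(1)$. Let $n\ge 1$ be an integer and let $f\colon\mathbb{R}\to\mathbb{R}$ be a function. Consider the following classes $\mathscr{X}$ of functions $\mathbb{R}\to\mathbb{R}$, each with a regularity condition on $\mathbf{D}f$: (i) for an integer $k\ge 0$, the $k$-times continuously differentiable functions; condition: $\mathbf{D}f$ is continuous at at least one point; (ii) for an integer $k\ge 1$, the $k$-times differentiable functions; condition: $\mathbf{D}f$ is continuous at at least one point; (iii) the real analytic functions; condition: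 $\mathbf{D}f$ is continuous at at least one point; (iv) the functions that are Riemann integrable on every bounded closed interval; (v) the functions that are absolutely continuous on every bounded closed interval; (vi) the functions that have bounded variation on every bounded closed interval; in (iv), (v) and (vi) the condition is: there is a Lebesgue measurable set $E\subseteq\mathbb{R}$ of positive measure such that $\mathbf{D}f$ is bounded on $E$, or there is such a set $E$ for which the restriction of $\mathbf{D}f$ to $E$ is Lebesgue measurable. Then, in each of the cases (i)--(vi) (and, in (i) and (ii), for each $k$), the following are equivalent: (a) $\Delta_h f\in\mathscr{X}$ for every $h\in\mathbb{R}$, and $\mathbf{D}f$ satisfies the regularity condition of that case; (b) there exist a derivation $d\colon\mathbb{R}\to\mathbb{R}$ of order $n$, a real number $\lambda$ and a function $\gamma\in\mathscr{X}$ such that $f(x)=d(x)+\lambda x+\gamma(x)$ for all $x\in\mathbb{R}$. -/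

import Mathlib

/-- The operator `δ_α f (x) = f (α x) - α f (x)`. -/
def scaleDiff (α : ℝ) (f : ℝ → ℝ) : ℝ → ℝ := fun x => f (α * x) - α * f x

/-- `d : ℝ → ℝ` is a derivation of order `n`: it is additive, `d 1 = 0`, and
`(δ_{α₁} ∘ ⋯ ∘ δ_{αₙ₊₁}) d (x) = 0` for all real `α₁, …, αₙ₊₁, x`.
The tuple `α₁, …, αₙ₊₁` is given as a list of length `n + 1`, and
`[α₁, …, αₙ₊₁].foldr scaleDiff d = scaleDiff α₁ (⋯ (scaleDiff αₙ₊₁ d))`. -/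
structure IsDerivationOfOrder (n : ℕ) (d : ℝ → ℝ) : Prop where
  map_add : ∀ x y : ℝ, d (x + y) = d x + d y
  map_one : d 1 = 0
  scaleDiff_eq_zero : ∀ l : List ℝ, l.length = n + 1 → ∀ x : ℝ, l.foldr scaleDiff d x = 0

/-- The function `(𝐃f)(α) = δ_α^{n+1} f (1)`. -/
def iterScaleDiffAtOne (n : ℕ) (f : ℝ → ℝ) : ℝ → ℝ := fun α => (scaleDiff α)^[n + 1] f 1

/-- `g` is bounded on a Lebesgue measurable set of positive measure.
(`NullMeasurableSet` with respect to `volume` is Lebesgue measurability.) -/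
def BoundedOnPosMeasureSet (g : ℝ → ℝ) : Prop :=
  ∃ E : Set ℝ, MeasureTheory.NullMeasurableSet E MeasureTheory.volume ∧
    0 < MeasureTheory.volume E ∧ ∃ M : ℝ, ∀ x ∈ E, |g x| ≤ M

/-- The restriction of `g` to some Lebesgue measurable set of positive measure is
Lebesgue measurable. -/
def MeasurableOnPosMeasureSet (g : ℝ → ℝ) : Prop :=
  ∃ E : Set ℝ, MeasureTheory.NullMeasurableSet E MeasureTheory.volume ∧
    0 < MeasureTheory.volume E ∧
    ∀ s : Set ℝ, MeasurableSet s →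
      MeasureTheory.NullMeasurableSet (E ∩ g ⁻¹' s) MeasureTheory.volume

/-- `f` is `k` times differentiable on `ℝ` (the `k`-th derivative need not be continuous). -/
def IsTimesDifferentiable (k : ℕ) (f : ℝ → ℝ) : Prop :=
  ∀ j : ℕ, j < k → Differentiable ℝ (iteratedDeriv j f)

/-- `f` is Riemann integrable on every bounded interval: Mathlib's Riemann integral over boxes,
for one-dimensional boxes, that is, Riemann sums over tagged partitions converge as the mesh
tends to zero. -/
def LocallyRiemannIntegrable (f : ℝ → ℝ) : Prop :=
  ∀ I : BoxIntegral.Box (Fin 1),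
    BoxIntegral.Integrable I BoxIntegral.IntegrationParams.Riemann
      (fun x : Fin 1 → ℝ => f (x 0)) BoxIntegral.BoxAdditiveMap.volume

/-- `f` is absolutely continuous on every bounded interval. -/
def LocallyAbsolutelyContinuous (f : ℝ → ℝ) : Prop :=
  ∀ a b : ℝ, a ≤ b → AbsolutelyContinuousOnInterval f a b

/-- `f = d + λ x + γ` with `d` a derivation of order `n`, `λ` a real number and `γ` in the
class `X`. -/
def HasDerivationDecomposition (n : ℕ) (X : (ℝ → ℝ) → Prop) (f : ℝ → ℝ) : Prop :=
  ∃ (d : ℝ → ℝ) (lam : ℝ) (γ : ℝ → ℝ), IsDerivationOfOrder n d ∧ X γ ∧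
    ∀ x : ℝ, f x = d x + lam * x + γ x

open MeasureTheory Filter Topology

/-!
The theorem combines de Bruijn's difference property of the six classes with a regularity theorem
for additive functions.

*Difference property.* If all differences `Δ_h f` lie in one of the classes, they are locally
Riemann integrable, that is, locally bounded and almost everywhere continuous
(`locallyRiemannIntegrable_iff_boundedAEContinuous`). Then
`A h = ∫_0^1 Δ_h f - ∫_0^h Δ_1 f` is additive, and `g = f - A` is Riemann integrable
(`exists_additive_add_boundedAEContinuous`). The main tool is
`exists_sum_abs_sub_le_of_fwdDiff`: a bound on sums `∑ |Δ_h g (x i) - Δ_h g (y i)|` that holds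
for each `h` with some constant holds, by Baire's theorem, with one constant for a set of `h` dense
in an interval. Since `Δ_h g (x) - Δ_h g (y) = Δ_x g (h) - Δ_y g (h) - (g x - g y)` is continuous in
`h` almost everywhere, the bound holds for almost every `h` of that interval, and averaging over `h`
bounds `∑ |g (x i) - g (y i)|`. With oscillation sums this gives Riemann integrability of `g`;
with partitions, and with families of disjoint intervals, it gives bounded variation and absolute
continuity.

A Riemann integrable `g` with continuous differences has a point of continuity, so it is
continuous. Similar arguments by Baire's theorem give one point of differentiability
(`differentiableAt_zero_of_fwdDiff`) or of analyticity (`analyticOnNhd_of_fwdDiff`), which the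
differences carry to all other points; higher derivatives follow by induction.

*Regularity.* Put `d x = A x - A 1 * x`. Then `𝐃d = 𝐃f - 𝐃g`, and `𝐃g` is locally bounded, so `𝐃d`
is bounded on a set of positive measure in each of the cases. In the ring `ℝ ⊗ ℝ` the operator `δ_a`
becomes multiplication by `1 ⊗ a - a ⊗ 1`, so that `𝐃d` is a generalized monomial of degree `n + 1`.
Taking differences in small directions lowers the degree and preserves boundedness on a set of
positive measure, so the symmetric multiadditive form of `𝐃d` vanishes
(`leadingForm_eq_zero_of_bounded`), and this form is `δ_{α₁} ⋯ δ_{αₙ₊₁} d (1)`.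
-/

/-! ### Additive functions with controlled iterated scale differences -/

open scoped Pointwise in
/-- A compact set of positive measure meets each of its small translates in positive measure. -/
theorem eventually_volume_inter_translate_pos {E : Set ℝ} (hE : IsCompact E)
    (hpos : 0 < volume E) : ∀ᶠ t : ℝ in 𝓝 0, 0 < volume (E ∩ (fun x => x + t) ⁻¹' E) := by
  have h := tendsto_measure_vadd_sdiff_isCompact_isClosed (μ := (volume : Measure ℝ)) hE hE.isClosed
  have h2 : Tendsto (fun t : ℝ => -t) (𝓝 0) (𝓝 0) := by
    simpa using (continuous_neg (G := ℝ)).tendsto 0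
  have h' := h.comp h2
  filter_upwards [(tendsto_order.1 h').2 _ hpos] with t ht
  have hset : (fun x => x + t) ⁻¹' E = (-t) +ᵥ E := by
    ext x
    simp only [Set.mem_preimage, Set.mem_vadd_set_iff_neg_vadd_mem, vadd_eq_add, neg_neg, add_comm t]
  have hmeas : volume ((fun x => x + t) ⁻¹' E) = volume E := measure_preimage_add_right _ _ _
  by_contra hzero
  have hzero' : volume ((fun x => x + t) ⁻¹' E ∩ E) = 0 := by
    rw [Set.inter_comm]; simpa using hzero
  have hle := measure_inter_add_sdiff₀ (μ := volume) ((fun x => x + t) ⁻¹' E)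
    hE.measurableSet.nullMeasurableSet
  rw [hzero', hmeas, zero_add, hset] at hle
  have : volume ((-t +ᵥ E) \ E) < volume E := ht
  exact absurd hle this.ne

/-- An additive function that vanishes at `1` and is bounded near `0` is zero: every real number
differs from a rational by an arbitrarily small amount. -/
theorem AddMonoidHom.eq_zero_of_eventually_bounded {g : ℝ →+ ℝ} (h1 : g 1 = 0) {M : ℝ}
    (hb : ∀ᶠ t in 𝓝 0, |g t| ≤ M) : g = 0 := by
  obtain ⟨ε, hε, hball⟩ := Metric.eventually_nhds_iff.1 hb
  have hq : ∀ q : ℚ, g q = 0 := fun q => by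
    have := map_ratCast_smul g ℝ ℝ q 1
    simpa [h1] using this
  have key : ∀ x, |g x| ≤ M := fun x => by
    obtain ⟨q, hq1, hq2⟩ := exists_rat_btwn (sub_lt_self x hε)
    have : |g (x - q)| ≤ M := hball (by
      rw [Real.dist_eq, sub_zero, abs_of_pos (by linarith)]; linarith)
    simpa [map_sub, hq] using this
  ext x
  by_contra hx
  have hx' : 0 < |g x| := abs_pos.2 hx
  obtain ⟨N, hN⟩ := exists_nat_gt (M / |g x|)
  have h2 := key (N • x)
  rw [map_nsmul, nsmul_eq_mul, abs_mul, Nat.abs_cast] at h2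
  rw [div_lt_iff₀ hx'] at hN
  linarith

/-- A generalized polynomial `x ↦ ∑_{j ≤ m} L_j (u(x)^j)`, with `u` additive and `u 1 = 0`, that is
bounded on a set of positive measure has vanishing leading multiadditive form.
The degree is lowered by passing to the difference `P(x + t) - P(x)` for small `t`, which is
bounded on the intersection of the set with a translate. -/
theorem leadingForm_eq_zero_of_bounded {R : Type*} [CommRing R] (u : ℝ →+ R) (hu : u 1 = 0)
    (m : ℕ) : ∀ (L : ℕ → R →+ ℝ) (E : Set ℝ) (M : ℝ), IsCompact E → 0 < volume E →
      (∀ x ∈ E, |∑ j ∈ Finset.range (m + 2), L j (u x ^ j)| ≤ M) →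
      ∀ w : List ℝ, w.length = m + 1 → L (m + 1) (w.map u).prod = 0 := by
  induction m with
  | zero =>
    intro L E M hE hpos hM w hw
    obtain ⟨a, rfl⟩ := List.length_eq_one_iff.1 hw
    have hzero : (L 1).comp u = 0 := by
      refine AddMonoidHom.eq_zero_of_eventually_bounded (M := 2 * M) (by simp [hu]) ?_
      filter_upwards [eventually_volume_inter_translate_pos hE hpos] with t ht
      obtain ⟨x, hx, hxt⟩ := nonempty_of_measure_ne_zero ht.ne'
      have h1 := abs_le.1 (hM x hx)
      have h2 := abs_le.1 (hM _ hxt)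
      simp only [Finset.sum_range_succ, Finset.range_zero, Finset.sum_empty, pow_zero, pow_one,
        map_add] at h1 h2
      simp only [AddMonoidHom.comp_apply]
      rw [abs_le]; constructor <;> linarith
    simpa using DFunLike.congr_fun hzero a
  | succ m ih =>
    intro L E M hE hpos hM w hw
    -- the coefficients of the difference in the direction `t`
    let L' : ℝ → ℕ → R →+ ℝ := fun t j => ∑ k ∈ (Finset.range (m + 3)).filter (j < ·),
      ((L k).comp (AddMonoidHom.mulLeft (u t ^ (k - j) * (k.choose j : R))))
    have hsum : ∀ t x, ∑ j ∈ Finset.range (m + 2), L' t j (u x ^ j) =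
        ∑ j ∈ Finset.range (m + 3), L j (u (x + t) ^ j) -
        ∑ j ∈ Finset.range (m + 3), L j (u x ^ j) := by
      intro t x
      have h1 : ∀ k, L k (u (x + t) ^ k) - L k (u x ^ k) =
          ∑ j ∈ Finset.range k, L k (u t ^ (k - j) * (k.choose j : R) * u x ^ j) := by
        intro k
        rw [map_add, add_pow, Finset.sum_range_succ, map_add, map_sum]
        simp only [Nat.sub_self, pow_zero, mul_one, Nat.choose_self, Nat.cast_one,
          add_sub_cancel_right]
        exact Finset.sum_congr rfl fun j _ => congrArg _ (by ring)
      rw [← Finset.sum_sub_distrib, Finset.sum_congr rfl fun k _ => h1 k]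
      simp only [L', AddMonoidHom.finsetSum_apply, AddMonoidHom.comp_apply,
        AddMonoidHom.coe_mulLeft]
      refine Finset.sum_comm' fun j k => ?_
      simp only [Finset.mem_range, Finset.mem_filter]
      omega
    have hlead : ∀ t, L' t (m + 1) = (m + 2) • (L (m + 2)).comp (AddMonoidHom.mulLeft (u t)) := by
      intro t
      have hf : (Finset.range (m + 3)).filter (m + 1 < ·) = {m + 2} := by
        ext k; simp only [Finset.mem_range, Finset.mem_filter, Finset.mem_singleton]; omega
      ext r
      simp only [L', hf, Finset.sum_singleton, AddMonoidHom.comp_apply, AddMonoidHom.coe_mulLeft,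
        AddMonoidHom.smul_apply]
      rw [← map_nsmul, nsmul_eq_mul, show m + 2 - (m + 1) = 1 by omega,
        Nat.choose_succ_self_right (m + 1)]
      congr 1
      push_cast
      ring
    match w, hw with
    | a :: w, hw =>
      have hw' : w.length = m + 1 := by simpa using hw
      have hsmall : ∀ᶠ t in 𝓝 (0 : ℝ), L (m + 2) (u t * (w.map u).prod) = 0 := by
        filter_upwards [eventually_volume_inter_translate_pos hE hpos] with t ht
        have h := ih (L' t) (E ∩ (fun x => x + t) ⁻¹' E) (M + M)
          (hE.inter_right (hE.isClosed.preimage (by fun_prop))) ht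
          (fun x hx => by
            rw [hsum]
            exact (abs_sub _ _).trans (add_le_add (hM _ hx.2) (hM _ hx.1))) w hw'
        rw [hlead, AddMonoidHom.smul_apply, smul_eq_zero] at h
        simpa using h
      -- a general direction is an integer multiple of a small one
      have htend : Tendsto (fun N : ℕ => a / (N : ℝ)) atTop (𝓝 0) :=
        tendsto_const_div_atTop_nhds_zero_nat a
      obtain ⟨N, hN, hN0⟩ := ((htend.eventually hsmall).and (eventually_gt_atTop 0)).exists
      have ha : a = N • (a / (N : ℝ)) := by
        rw [nsmul_eq_mul]; field_simp
      rw [List.map_cons, List.prod_cons, ha, map_nsmul, smul_mul_assoc, map_nsmul, hN, smul_zero]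

open scoped TensorProduct

/-- The element `1 ⊗ a - a ⊗ 1` of `ℝ ⊗ ℝ`, which encodes the operator `δ_a`. -/
noncomputable def tensorScaleDiff : ℝ →+ ℝ ⊗[ℤ] ℝ where
  toFun a := 1 ⊗ₜ a - a ⊗ₜ 1
  map_zero' := by simp
  map_add' a b := by rw [TensorProduct.tmul_add, TensorProduct.add_tmul]; abel

/-- The functional `a ⊗ b ↦ a * d b` on `ℝ ⊗ ℝ` attached to an additive function `d`. -/
noncomputable def tensorEval (d : ℝ →+ ℝ) : ℝ ⊗[ℤ] ℝ →+ ℝ :=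
  TensorProduct.liftAddHom ((AddMonoidHom.mul (R := ℝ)).compr₂ (AddMonoidHom.id ℝ) |>.compl₂ d)
    (by
      intro r a b
      have h : d (r * b) = r * d b := by
        rw [← zsmul_eq_mul, map_zsmul, zsmul_eq_mul]
      simp only [zsmul_eq_mul, AddMonoidHom.compl₂_apply, AddMonoidHom.compr₂_apply,
        AddMonoidHom.id_apply, AddMonoidHom.mul_apply, h]
      ring)

theorem tensorEval_tmul_mul (d : ℝ →+ ℝ) (a : ℝ) (w : ℝ ⊗[ℤ] ℝ) :
    tensorEval d ((a ⊗ₜ 1) * w) = a * tensorEval d w := by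
  induction w with
  | zero => simp
  | tmul b c => simp [tensorEval, mul_assoc]
  | add x y hx hy => rw [mul_add, map_add, map_add, hx, hy, mul_add]

/-- Iterated scale differences of an additive function, written through `ℝ ⊗ ℝ`. -/
theorem foldr_scaleDiff_eq_tensorEval (d : ℝ →+ ℝ) (l : List ℝ) (x : ℝ) :
    l.foldr scaleDiff d x = tensorEval d ((1 ⊗ₜ x) * (l.map tensorScaleDiff).prod) := by
  induction l generalizing x with
  | nil => simp [tensorEval]
  | cons a l ih =>
    rw [List.foldr_cons, scaleDiff, ih, ih, ← tensorEval_tmul_mul, ← map_sub, List.map_cons,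
      List.prod_cons, ← mul_assoc, ← mul_assoc, ← sub_mul]
    congr 2
    change (1 ⊗ₜ[ℤ] (a * x) : ℝ ⊗[ℤ] ℝ) - (a ⊗ₜ 1) * (1 ⊗ₜ x) =
      (1 ⊗ₜ x) * ((1 ⊗ₜ a) - (a ⊗ₜ 1))
    rw [mul_sub]
    simp only [Algebra.TensorProduct.tmul_mul_tmul, mul_one, one_mul, mul_comm x a]

theorem iterScaleDiffAtOne_eq_foldr (n : ℕ) (f : ℝ → ℝ) (a : ℝ) :
    iterScaleDiffAtOne n f a = (List.replicate (n + 1) a).foldr scaleDiff f 1 := by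
  have : ∀ k, (scaleDiff a)^[k] f = (List.replicate k a).foldr scaleDiff f := by
    intro k
    induction k with
    | zero => rfl
    | succ k ih => rw [Function.iterate_succ_apply', ih, List.replicate_succ, List.foldr_cons]
  rw [iterScaleDiffAtOne, this]

theorem IsDerivationOfOrder.iterScaleDiffAtOne_eq_zero {n : ℕ} {d : ℝ → ℝ}
    (hd : IsDerivationOfOrder n d) (a : ℝ) : iterScaleDiffAtOne n d a = 0 := by
  rw [iterScaleDiffAtOne_eq_foldr]
  exact hd.scaleDiff_eq_zero _ (by simp) 1

theorem scaleDiff_add (a : ℝ) (f g : ℝ → ℝ) :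
    scaleDiff a (fun x => f x + g x) = fun x => scaleDiff a f x + scaleDiff a g x := by
  funext x; simp only [scaleDiff]; ring

theorem iterScaleDiffAtOne_add (n : ℕ) (f g : ℝ → ℝ) (a : ℝ) :
    iterScaleDiffAtOne n (fun x => f x + g x) a =
      iterScaleDiffAtOne n f a + iterScaleDiffAtOne n g a := by
  have : ∀ k, (scaleDiff a)^[k] (fun x => f x + g x) =
      fun x => (scaleDiff a)^[k] f x + (scaleDiff a)^[k] g x := by
    intro k
    induction k with
    | zero => rfl
    | succ k ih => simp only [Function.iterate_succ_apply', ih, scaleDiff_add]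
  simp only [iterScaleDiffAtOne, this]

/-- `g` is bounded on every bounded interval. -/
def LocallyBoundedFun (g : ℝ → ℝ) : Prop := ∀ K : ℝ, ∃ M : ℝ, ∀ x, |x| ≤ K → |g x| ≤ M

theorem LocallyBoundedFun.sub {f g : ℝ → ℝ} (hf : LocallyBoundedFun f)
    (hg : LocallyBoundedFun g) : LocallyBoundedFun (fun x => f x - g x) := fun K => by
  obtain ⟨M, hM⟩ := hf K
  obtain ⟨N, hN⟩ := hg K
  exact ⟨M + N, fun x hx => (abs_sub _ _).trans (add_le_add (hM x hx) (hN x hx))⟩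

theorem Continuous.locallyBoundedFun {g : ℝ → ℝ} (hg : Continuous g) : LocallyBoundedFun g :=
  fun K => by
    obtain ⟨M, hM⟩ := (isCompact_Icc (a := -K) (b := K)).exists_bound_of_continuousOn
      hg.continuousOn
    exact ⟨M, fun x hx => hM x (abs_le.1 hx)⟩

theorem LocallyBoundedFun.iterScaleDiffAtOne {g : ℝ → ℝ} (hg : LocallyBoundedFun g) (n : ℕ) :
    LocallyBoundedFun (iterScaleDiffAtOne n g) := by
  intro N
  have key : ∀ k : ℕ, ∀ K : ℝ, ∃ M, ∀ a, |a| ≤ N → ∀ x, |x| ≤ K →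
      |(scaleDiff a)^[k] g x| ≤ M := by
    intro k
    induction k with
    | zero =>
      intro K
      obtain ⟨M, hM⟩ := hg K
      exact ⟨M, fun a _ x hx => hM x hx⟩
    | succ k ih =>
      intro K
      obtain ⟨M₁, h₁⟩ := ih (N * K)
      obtain ⟨M₂, h₂⟩ := ih K
      refine ⟨M₁ + N * M₂, fun a ha x hx => ?_⟩
      rw [Function.iterate_succ_apply', scaleDiff]
      refine (abs_sub _ _).trans (add_le_add (h₁ a ha _ ?_) ?_)
      · rw [abs_mul]
        exact mul_le_mul ha hx (abs_nonneg _) ((abs_nonneg _).trans ha)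
      · rw [abs_mul]
        exact mul_le_mul ha (h₂ a ha x hx) (abs_nonneg _) ((abs_nonneg _).trans ha)
  obtain ⟨M, hM⟩ := key (n + 1) 1
  exact ⟨M, fun a ha => hM a ha 1 (by simp)⟩

theorem Continuous.iterScaleDiffAtOne {g : ℝ → ℝ} (hg : Continuous g) (n : ℕ) :
    Continuous (iterScaleDiffAtOne n g) := by
  have key : ∀ k : ℕ, Continuous fun p : ℝ × ℝ => (scaleDiff p.1)^[k] g p.2 := by
    intro k
    induction k with
    | zero => exact hg.comp continuous_snd
    | succ k ih =>
      simp only [Function.iterate_succ_apply', scaleDiff]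
      exact (ih.comp (by fun_prop : Continuous fun p : ℝ × ℝ => (p.1, p.1 * p.2))).sub
        (continuous_fst.mul ih)
  exact (key (n + 1)).comp (by fun_prop : Continuous fun a : ℝ => (a, (1 : ℝ)))

theorem BoundedOnPosMeasureSet.exists_isCompact {g : ℝ → ℝ} (hg : BoundedOnPosMeasureSet g) :
    ∃ E : Set ℝ, IsCompact E ∧ 0 < volume E ∧ ∃ M : ℝ, ∀ x ∈ E, |g x| ≤ M := by
  obtain ⟨E, hE, hpos, M, hM⟩ := hg
  obtain ⟨t, htE, htm, hae⟩ := hE.exists_measurable_subset_ae_eq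
  rw [← measure_congr hae] at hpos
  obtain ⟨K, hKt, hK, hKpos⟩ := htm.exists_lt_isCompact hpos
  exact ⟨K, hK, hKpos, M, fun x hx => hM x (htE (hKt hx))⟩

/-- A function measurable on a set of positive measure is bounded on a smaller one. -/
theorem MeasurableOnPosMeasureSet.boundedOnPosMeasureSet {g : ℝ → ℝ}
    (hg : MeasurableOnPosMeasureSet g) : BoundedOnPosMeasureSet g := by
  obtain ⟨E, -, hpos, hmeas⟩ := hg
  have hcover : E = ⋃ m : ℕ, E ∩ g ⁻¹' Set.Icc (-m : ℝ) m := by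
    ext x
    simp only [Set.mem_iUnion, Set.mem_inter_iff, Set.mem_preimage, Set.mem_Icc, ← abs_le]
    exact ⟨fun hx => ⟨⌈|g x|⌉₊, hx, Nat.le_ceil _⟩, fun ⟨_, hx, _⟩ => hx⟩
  rw [hcover] at hpos
  obtain ⟨m, hm⟩ := exists_measure_pos_of_not_measure_iUnion_null hpos.ne'
  exact ⟨_, hmeas _ measurableSet_Icc, hm, m, fun x hx => abs_le.2 hx.2⟩

/-- After passing to a compact subset of positive measure, the locally bounded function is bounded
there too. -/
theorem BoundedOnPosMeasureSet.sub_locallyBoundedFun {g k : ℝ → ℝ}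
    (hg : BoundedOnPosMeasureSet g) (hk : LocallyBoundedFun k) :
    BoundedOnPosMeasureSet (fun x => g x - k x) := by
  obtain ⟨E, hE, hpos, M, hM⟩ := hg.exists_isCompact
  obtain ⟨K, hK⟩ := hE.isBounded.subset_closedBall 0
  obtain ⟨N, hN⟩ := hk K
  refine ⟨E, hE.measurableSet.nullMeasurableSet, hpos, M + N, fun x hx => ?_⟩
  refine (abs_sub _ _).trans (add_le_add (hM x hx) (hN x ?_))
  simpa using hK hx

theorem LocallyBoundedFun.boundedOnPosMeasureSet {g : ℝ → ℝ} (hg : LocallyBoundedFun g) :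
    BoundedOnPosMeasureSet g := by
  obtain ⟨M, hM⟩ := hg 1
  exact ⟨Set.Icc 0 1, measurableSet_Icc.nullMeasurableSet, by simp, M,
    fun x hx => hM x (abs_le.2 ⟨by linarith [hx.1], hx.2⟩)⟩

theorem ContinuousAt.boundedOnPosMeasureSet {g : ℝ → ℝ} {a : ℝ} (hg : ContinuousAt g a) :
    BoundedOnPosMeasureSet g := by
  obtain ⟨ε, hε, h⟩ := Metric.continuousAt_iff.1 hg 1 one_pos
  refine ⟨Metric.ball a ε, measurableSet_ball.nullMeasurableSet, Metric.measure_ball_pos _ _ hε,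
    |g a| + 1, fun x hx => ?_⟩
  have h1 := h hx
  rw [Real.dist_eq] at h1
  have h2 := abs_add_le (g x - g a) (g a)
  rw [sub_add_cancel] at h2
  linarith

/-- An additive `d` with `d 1 = 0` for which `𝐃d` is bounded on a set of positive measure is a
derivation of order `n`. -/
theorem isDerivationOfOrder_of_boundedOnPosMeasureSet {n : ℕ} (d : ℝ →+ ℝ) (h1 : d 1 = 0)
    (hd : BoundedOnPosMeasureSet (iterScaleDiffAtOne n d)) : IsDerivationOfOrder n d := by
  obtain ⟨E, hE, hpos, M, hM⟩ := hd.exists_isCompact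
  have hone : ∀ l : List ℝ, l.length = n + 1 → l.foldr scaleDiff d 1 = 0 := by
    intro l hl
    have h := leadingForm_eq_zero_of_bounded tensorScaleDiff (by simp [tensorScaleDiff]) n
      (fun j => if j = n + 1 then tensorEval d else 0) E M hE hpos (fun x hx => ?_) l hl
    · rw [foldr_scaleDiff_eq_tensorEval, ← Algebra.TensorProduct.one_def, one_mul]
      simpa using h
    · have h2 := hM x hx
      rw [iterScaleDiffAtOne_eq_foldr, foldr_scaleDiff_eq_tensorEval,
        ← Algebra.TensorProduct.one_def, one_mul, List.map_replicate, List.prod_replicate] at h2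
      rw [Finset.sum_eq_single_of_mem (n + 1) (by simp)]
      · simpa using h2
      · intro j _ hj; simp [hj]
  refine ⟨map_add d, h1, fun l hl x => ?_⟩
  match l, hl with
  | a :: l, hl =>
    -- vanishing at `1` for every first entry makes the inner function linear
    have hlin : ∀ y, l.foldr scaleDiff d y = y * l.foldr scaleDiff d 1 := fun y => by
      have := hone (y :: l) (by simpa using hl)
      simp only [List.foldr_cons, scaleDiff, mul_one] at this
      linarith
    rw [List.foldr_cons, scaleDiff, hlin, hlin x]
    ring

/-! ### Lebesgue's criterion for Riemann integrability -/

/-- `g` is locally bounded and continuous almost everywhere: by Lebesgue's criterion, `g` is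
Riemann integrable on bounded intervals. -/
structure BoundedAEContinuous (g : ℝ → ℝ) : Prop where
  bounded : LocallyBoundedFun g
  ae_continuousAt : ∀ᵐ x, ContinuousAt g x

/-- Darboux's criterion on all intervals `[-K, K]`, for uniform partitions: for each fine enough
mesh `1 / N`, the sum of `|g (x i) - g (y i)| / N` over the cells `[i / N, (i + 1) / N]` of
`[-K, K]` is small, whatever the points `x i`, `y i` of the cells. -/
def SmallOscillationSums (g : ℝ → ℝ) : Prop :=
  ∀ K : ℕ, ∀ ε : ℝ, 0 < ε → ∃ N₀ : ℕ, ∀ N : ℕ, N₀ ≤ N → 0 < N → ∀ x y : ℤ → ℝ,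
    (∀ i : ℤ, x i ∈ Set.Icc ((i : ℝ) / N) ((i + 1) / N)) →
    (∀ i : ℤ, y i ∈ Set.Icc ((i : ℝ) / N) ((i + 1) / N)) →
    ∑ i ∈ Finset.Ico (-(K * N) : ℤ) (K * N), |g (x i) - g (y i)| ≤ ε * N

theorem BoundedAEContinuous.locallyRiemannIntegrable {g : ℝ → ℝ} (hg : BoundedAEContinuous g) :
    LocallyRiemannIntegrable g := by
  intro I
  have hae : ∀ᵐ x : Fin 1 → ℝ, ContinuousAt (fun x : Fin 1 → ℝ => g (x 0)) x := by
    have h := (volume_preserving_funUnique (Fin 1) ℝ).quasiMeasurePreserving.ae hg.ae_continuousAt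
    filter_upwards [h] with x hx
    have hx' : ContinuousAt g (x 0) := hx
    exact Tendsto.comp hx' (continuous_apply (A := fun _ : Fin 1 => ℝ) 0).continuousAt
  have hb : ∃ C : ℝ, ∀ x ∈ BoxIntegral.Box.Icc I, ‖g (x 0)‖ ≤ C := by
    obtain ⟨M, hM⟩ := hg.bounded (max |I.lower 0| |I.upper 0|)
    exact ⟨M, fun x hx => hM _ (abs_le_max_abs_abs (hx.1 0) (hx.2 0))⟩
  unfold BoxIntegral.BoxAdditiveMap.volume
  exact BoxIntegral.integrable_of_bounded_and_ae_continuous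
    BoxIntegral.IntegrationParams.Riemann hb volume hae

/-- The one-dimensional box with endpoints `-K` and `K`; as a set it is `(-K, K]`. -/
def symmetricBox (K : ℕ) (hK : 0 < K) : BoxIntegral.Box (Fin 1) where
  lower := fun _ => -(K : ℝ)
  upper := fun _ => (K : ℝ)
  lower_lt_upper := fun _ => by
    have : (0 : ℝ) < K := by exact_mod_cast hK
    linarith

theorem mem_admissibleIndex_symmetricBox {K : ℕ} (hK : 0 < K) {N : ℕ} [NeZero N]
    {ν : Fin 1 → ℤ} : ν ∈ BoxIntegral.unitPartition.admissibleIndex N (symmetricBox K hK) ↔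
      ν 0 ∈ Finset.Ico (-(K * N) : ℤ) (K * N) := by
  have hN : (0 : ℝ) < N := by exact_mod_cast NeZero.pos N
  rw [BoxIntegral.unitPartition.mem_admissibleIndex_iff, BoxIntegral.Box.le_iff_bounds,
    Finset.mem_Ico, Pi.le_def, Pi.le_def]
  simp only [symmetricBox, BoxIntegral.unitPartition.box_lower,
    BoxIntegral.unitPartition.box_upper, Fin.forall_fin_one]
  rw [le_div_iff₀ hN, div_le_iff₀ hN]
  constructor
  · rintro ⟨h1, h2⟩
    have h1' : (-(K * N) : ℤ) ≤ ν 0 := by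
      have : ((-(K * N) : ℤ) : ℝ) ≤ ν 0 := by push_cast; linarith
      exact_mod_cast this
    have h2' : ν 0 + 1 ≤ (K * N : ℤ) := by exact_mod_cast h2
    exact ⟨h1', by omega⟩
  · rintro ⟨h1, h2⟩
    have h1' : ((-(K * N) : ℤ) : ℝ) ≤ ν 0 := by exact_mod_cast h1
    have h2' : ((ν 0 + 1 : ℤ) : ℝ) ≤ ((K * N : ℤ) : ℝ) := by exact_mod_cast h2
    push_cast at h1' h2'
    exact ⟨by linarith, by linarith⟩

open Classical in
/-- The uniform partition of `[-K, K]` of mesh `1 / N`, with tag `t i` in the cell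
`[i / N, (i + 1) / N]`. Boxes that are not cells get the upper corner as a dummy tag. -/
noncomputable def uniformTagged (K : ℕ) (hK : 0 < K) (N : ℕ) [NeZero N] (t : ℤ → ℝ)
    (ht : ∀ i : ℤ, t i ∈ Set.Icc ((i : ℝ) / N) ((i + 1) / N)) :
    BoxIntegral.TaggedPrepartition (symmetricBox K hK) where
  toPrepartition :=
    (BoxIntegral.unitPartition.prepartition N (symmetricBox K hK)).toPrepartition
  tag I := if I ∈ BoxIntegral.unitPartition.prepartition N (symmetricBox K hK) then
      fun _ => t (BoxIntegral.unitPartition.index N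
        ((BoxIntegral.unitPartition.prepartition N (symmetricBox K hK)).tag I) 0)
    else (symmetricBox K hK).upper
  tag_mem_Icc I := by
    split_ifs with h
    · obtain ⟨ν, hν, rfl⟩ := BoxIntegral.unitPartition.mem_prepartition_iff.1 h
      rw [BoxIntegral.unitPartition.prepartition_tag N hν, BoxIntegral.unitPartition.index_tag]
      have hle := BoxIntegral.unitPartition.mem_admissibleIndex_iff.1 hν
      rw [BoxIntegral.Box.le_iff_Icc] at hle
      refine hle ⟨?_, ?_⟩ <;> intro i <;> rw [Subsingleton.elim i 0]
      · simpa using (ht (ν 0)).1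
      · simpa using (ht (ν 0)).2
    · exact (symmetricBox K hK).upper_mem_Icc

theorem uniformTagged_tag {K : ℕ} {hK : 0 < K} {N : ℕ} [NeZero N] {t : ℤ → ℝ}
    {ht : ∀ i : ℤ, t i ∈ Set.Icc ((i : ℝ) / N) ((i + 1) / N)} {ν : Fin 1 → ℤ}
    (hν : ν ∈ BoxIntegral.unitPartition.admissibleIndex N (symmetricBox K hK)) :
    (uniformTagged K hK N t ht).tag (BoxIntegral.unitPartition.box N ν) = fun _ => t (ν 0) := by
  have h : BoxIntegral.unitPartition.box N ν ∈
      BoxIntegral.unitPartition.prepartition N (symmetricBox K hK) :=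
    BoxIntegral.unitPartition.mem_prepartition_iff.2 ⟨ν, hν, rfl⟩
  simp only [uniformTagged, if_pos h, BoxIntegral.unitPartition.prepartition_tag N hν,
    BoxIntegral.unitPartition.index_tag]

theorem uniformTagged_isHenstock {K : ℕ} {hK : 0 < K} {N : ℕ} [NeZero N] {t : ℤ → ℝ}
    {ht : ∀ i : ℤ, t i ∈ Set.Icc ((i : ℝ) / N) ((i + 1) / N)} :
    (uniformTagged K hK N t ht).IsHenstock := by
  intro J hJ
  obtain ⟨ν, hν, rfl⟩ := BoxIntegral.unitPartition.mem_prepartition_iff.1 hJ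
  rw [uniformTagged_tag hν]
  refine ⟨?_, ?_⟩ <;> intro i <;> rw [Subsingleton.elim i 0]
  · simpa using (ht (ν 0)).1
  · simpa using (ht (ν 0)).2

theorem uniformTagged_isSubordinate {K : ℕ} {hK : 0 < K} {N : ℕ} [NeZero N] {t : ℤ → ℝ}
    {ht : ∀ i : ℤ, t i ∈ Set.Icc ((i : ℝ) / N) ((i + 1) / N)} {r : (Fin 1 → ℝ) → Set.Ioi (0 : ℝ)}
    (hr : ∀ x, (1 : ℝ) / N ≤ r x) : (uniformTagged K hK N t ht).IsSubordinate r := by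
  intro J hJ
  have hH := uniformTagged_isHenstock (ht := ht) J hJ
  obtain ⟨ν, hν, rfl⟩ := BoxIntegral.unitPartition.mem_prepartition_iff.1 hJ
  intro x hx
  exact (Metric.dist_le_diam_of_mem (BoxIntegral.Box.isBounded_Icc _) hx hH).trans
    ((BoxIntegral.unitPartition.diam_boxIcc N ν).trans (hr _))

theorem uniformTagged_isPartition {K : ℕ} {hK : 0 < K} {N : ℕ} [NeZero N] {t : ℤ → ℝ}
    {ht : ∀ i : ℤ, t i ∈ Set.Icc ((i : ℝ) / N) ((i + 1) / N)} :
    (uniformTagged K hK N t ht).IsPartition :=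
  BoxIntegral.unitPartition.prepartition_isPartition N
    ⟨fun _ => -(K : ℤ), fun _ => (K : ℤ), fun _ => by simp [symmetricBox],
      fun _ => by simp [symmetricBox]⟩

theorem integralSum_uniformTagged (g : ℝ → ℝ) {K : ℕ} {hK : 0 < K} {N : ℕ} [NeZero N] {t : ℤ → ℝ}
    {ht : ∀ i : ℤ, t i ∈ Set.Icc ((i : ℝ) / N) ((i + 1) / N)} :
    BoxIntegral.integralSum (fun x : Fin 1 → ℝ => g (x 0)) BoxIntegral.BoxAdditiveMap.volume
      (uniformTagged K hK N t ht) =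
      ∑ i ∈ Finset.Ico (-(K * N) : ℤ) (K * N), (1 / N : ℝ) * g (t i) := by
  symm
  refine Finset.sum_nbij (fun i => BoxIntegral.unitPartition.box N fun _ => i) ?_ ?_ ?_ ?_
  · intro i hi
    exact BoxIntegral.unitPartition.mem_prepartition_iff.2
      ⟨_, (mem_admissibleIndex_symmetricBox hK).2 hi, rfl⟩
  · intro i _ j _ hij
    exact congrFun (BoxIntegral.unitPartition.box_injective N hij) 0
  · intro J hJ
    obtain ⟨ν, hν, rfl⟩ := BoxIntegral.unitPartition.mem_prepartition_iff.1 hJ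
    refine ⟨ν 0, (mem_admissibleIndex_symmetricBox hK).1 hν, ?_⟩
    have : (fun _ => ν 0) = ν := by ext i; rw [Subsingleton.elim i 0]
    simp only [this]
  · intro i hi
    rw [uniformTagged_tag ((mem_admissibleIndex_symmetricBox (ν := fun _ => i) hK).2 hi)]
    rw [BoxIntegral.BoxAdditiveMap.volume_apply]
    simp only [BoxIntegral.unitPartition.box.upper_sub_lower, Finset.univ_unique,
      Finset.prod_const, Finset.card_singleton, pow_one, smul_eq_mul]

theorem LocallyRiemannIntegrable.smallOscillationSums {g : ℝ → ℝ}
    (hg : LocallyRiemannIntegrable g) : SmallOscillationSums g := by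
  intro K ε hε
  rcases Nat.eq_zero_or_pos K with rfl | hK
  · refine ⟨0, fun N _ hN x y _ _ => ?_⟩
    simp only [CharP.cast_eq_zero, zero_mul, neg_zero, Finset.Ico_self, Finset.sum_empty]
    positivity
  obtain ⟨r, hr, hcauchy⟩ :=
    BoxIntegral.integrable_iff_cauchy_basis.1 (hg (symmetricBox K hK)) ε hε
  obtain ⟨N₀, hN₀⟩ := exists_nat_gt (1 / (r 0 0 : ℝ))
  refine ⟨N₀, fun N hN hNpos x y hx hy => ?_⟩
  have : NeZero N := ⟨hNpos.ne'⟩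
  have hNr : (0 : ℝ) < N := by exact_mod_cast hNpos
  have hr0 : (0 : ℝ) < r 0 0 := (r 0 0).2
  have hmesh : ∀ z, (1 : ℝ) / N ≤ r 0 z := fun z => by
    rw [hr 0 rfl z, div_le_iff₀ hNr, mul_comm, ← div_le_iff₀ hr0]
    exact hN₀.le.trans (by exact_mod_cast hN)
  have hmem : ∀ (t : ℤ → ℝ) (ht : ∀ i : ℤ, t i ∈ Set.Icc ((i : ℝ) / N) ((i + 1) / N)),
      BoxIntegral.IntegrationParams.Riemann.MemBaseSet (symmetricBox K hK) 0 (r 0)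
        (uniformTagged K hK N t ht) := fun t ht =>
    { isSubordinate := uniformTagged_isSubordinate hmesh
      isHenstock := fun _ => uniformTagged_isHenstock
      distortion_le := fun h => by cases h
      exists_compl := fun h => by cases h }
  -- choose the tags in each cell so that no cancellation occurs
  have hsum := hcauchy 0 0 _ _
    (hmem (fun i => if g (y i) ≤ g (x i) then x i else y i)
      (fun i => by split_ifs; exacts [hx i, hy i])) uniformTagged_isPartition
    (hmem (fun i => if g (y i) ≤ g (x i) then y i else x i)
      (fun i => by split_ifs; exacts [hy i, hx i])) uniformTagged_isPartition
  rw [integralSum_uniformTagged, integralSum_uniformTagged, Real.dist_eq,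
    ← Finset.sum_sub_distrib] at hsum
  have hterm : ∀ i, (1 / N : ℝ) * g (if g (y i) ≤ g (x i) then x i else y i) -
      (1 / N : ℝ) * g (if g (y i) ≤ g (x i) then y i else x i) =
      (1 / N : ℝ) * |g (x i) - g (y i)| := fun i => by
    split_ifs with h
    · rw [abs_of_nonneg (sub_nonneg.2 h), mul_sub]
    · rw [abs_of_nonpos (by linarith), neg_sub, mul_sub]
  rw [Finset.sum_congr rfl fun i _ => hterm i, ← Finset.mul_sum] at hsum
  have h2 := (le_abs_self _).trans hsum
  rw [one_div, inv_mul_le_iff₀ hNr] at h2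
  rwa [mul_comm ε]

theorem SmallOscillationSums.locallyBoundedFun {g : ℝ → ℝ} (hg : SmallOscillationSums g) :
    LocallyBoundedFun g := by
  intro K'
  obtain ⟨K, hK⟩ := exists_nat_gt K'
  obtain ⟨N₀, hN₀⟩ := hg K 1 one_pos
  set N := max N₀ 1 with hNdef
  have hNpos : 0 < N := lt_of_lt_of_le one_pos (le_max_right _ _)
  have hNr : (0 : ℝ) < N := by exact_mod_cast hNpos
  refine ⟨N + ∑ i ∈ Finset.Ico (-(K * N) : ℤ) (K * N), |g (i / N)|, fun x hx => ?_⟩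
  have hx1 := abs_lt.1 (hx.trans_lt hK)
  set j := ⌊x * N⌋ with hj
  have hj1 : (j : ℝ) ≤ x * N := Int.floor_le _
  have hj2 : x * N < j + 1 := Int.lt_floor_add_one _
  have hmemj : j ∈ Finset.Ico (-(K * N) : ℤ) (K * N) := by
    rw [Finset.mem_Ico]
    constructor
    · rw [hj, Int.le_floor]; push_cast; nlinarith
    · have : (j : ℝ) < (K * N : ℤ) := by push_cast; nlinarith
      exact_mod_cast this
  have hcell : ∀ i : ℤ, (i : ℝ) / N ∈ Set.Icc ((i : ℝ) / N) ((i + 1) / N) := fun i =>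
    ⟨le_rfl, by gcongr; linarith⟩
  have hosc := hN₀ N (le_max_left _ _) hNpos (fun i => if i = j then x else i / N)
    (fun i => i / N) (fun i => by
      split_ifs with h
      · subst h
        exact ⟨by rwa [div_le_iff₀ hNr], by rw [le_div_iff₀ hNr]; exact hj2.le⟩
      · exact hcell i) hcell
  have h1 := (Finset.single_le_sum (f := fun i : ℤ =>
    |g (if i = j then x else i / N) - g (i / N)|) (fun i _ => abs_nonneg _) hmemj).trans hosc
  simp only [if_true, one_mul] at h1
  have h2 := Finset.single_le_sum (f := fun i : ℤ => |g (i / N)|) (fun i _ => abs_nonneg _) hmemj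
  have h3 := abs_add_le (g x - g (j / N)) (g (j / N))
  rw [sub_add_cancel] at h3
  linarith

/-- The points at which the oscillation is at least `ε` are covered, up to the division points, by
the cells of large oscillation, and the oscillation sums bound the number of these. -/
theorem SmallOscillationSums.ae_oscillation_lt {g : ℝ → ℝ} (hg : SmallOscillationSums g)
    {ε : ℝ} (hε : 0 < ε) :
    ∀ᵐ x, ∃ δ > 0, ∀ y, |y - x| < δ → |g y - g x| < ε := by
  set D : Set ℝ := {x | ¬ ∃ δ > 0, ∀ y, |y - x| < δ → |g y - g x| < ε} with hD
  have hK : ∀ K : ℕ, volume (D ∩ Set.Ioo (-K : ℝ) K) = 0 := by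
    intro K
    refine le_antisymm (ENNReal.le_of_forall_pos_le_add fun η hη _ => ?_) bot_le
    rw [zero_add]
    have hη' : (0 : ℝ) < η := hη
    obtain ⟨N₀, hN₀⟩ := hg K (η * ε) (by positivity)
    set N := max N₀ 1 with hNdef
    have hNpos : 0 < N := lt_of_lt_of_le one_pos (le_max_right _ _)
    have hNr : (0 : ℝ) < N := by exact_mod_cast hNpos
    have hcell : ∀ i : ℤ, (i : ℝ) / N ∈ Set.Icc ((i : ℝ) / N) ((i + 1) / N) := fun i =>
      ⟨le_rfl, by gcongr; linarith⟩
    let bad : ℤ → Prop := fun i => ∃ x y : ℝ, x ∈ Set.Icc ((i : ℝ) / N) ((i + 1) / N) ∧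
      y ∈ Set.Icc ((i : ℝ) / N) ((i + 1) / N) ∧ ε ≤ |g x - g y|
    have hchoice : ∀ i : ℤ, ∃ x y : ℝ, x ∈ Set.Icc ((i : ℝ) / N) ((i + 1) / N) ∧
        y ∈ Set.Icc ((i : ℝ) / N) ((i + 1) / N) ∧ (bad i → ε ≤ |g x - g y|) := fun i => by
      by_cases h : bad i
      · obtain ⟨x, y, hx, hy, hxy⟩ := h
        exact ⟨x, y, hx, hy, fun _ => hxy⟩
      · exact ⟨_, _, hcell i, hcell i, fun h' => absurd h' h⟩
    choose x y hx hy hxy using hchoice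
    have hosc := hN₀ N (le_max_left _ _) hNpos x y hx hy
    classical
    set B := (Finset.Ico (-(K * N) : ℤ) (K * N)).filter bad with hB
    have hcard : (B.card : ℝ) * ε ≤ η * ε * N := by
      refine le_trans ?_ hosc
      rw [← nsmul_eq_mul]
      refine (Finset.card_nsmul_le_sum B _ ε fun i hi => hxy i (Finset.mem_filter.1 hi).2).trans
        (Finset.sum_le_sum_of_subset_of_nonneg (Finset.filter_subset _ _)
          fun _ _ _ => abs_nonneg _)
    have hcover : D ∩ Set.Ioo (-K : ℝ) K ⊆
        (⋃ i ∈ B, Set.Icc ((i : ℝ) / N) ((i + 1) / N)) ∪ Set.range fun i : ℤ => (i : ℝ) / N := by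
      rintro z ⟨hzD, hz1, hz2⟩
      by_cases hr : z ∈ Set.range fun i : ℤ => (i : ℝ) / N
      · exact Or.inr hr
      left
      set j := ⌊z * N⌋ with hj
      have hj1 : (j : ℝ) ≤ z * N := Int.floor_le _
      have hj2 : z * N < j + 1 := Int.lt_floor_add_one _
      have hj1' : (j : ℝ) / N < z := by
        refine lt_of_le_of_ne (by rwa [div_le_iff₀ hNr]) fun h => hr ⟨j, h⟩
      have hj2' : z < (j + 1) / N := by rwa [lt_div_iff₀ hNr]
      have hmemj : j ∈ Finset.Ico (-(K * N) : ℤ) (K * N) := by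
        rw [Finset.mem_Ico]
        constructor
        · rw [hj, Int.le_floor]; push_cast; nlinarith
        · have : (j : ℝ) < (K * N : ℤ) := by push_cast; nlinarith
          exact_mod_cast this
      simp only [hD, Set.mem_ofPred_eq, not_exists, not_and, not_forall, not_lt] at hzD
      obtain ⟨w, hw, hgw⟩ := hzD (min (z - j / N) ((j + 1) / N - z))
        (lt_min (by linarith) (by linarith))
      have hw' := abs_lt.1 hw
      have hm1 := min_le_left (z - (j : ℝ) / N) ((j + 1) / N - z)
      have hm2 := min_le_right (z - (j : ℝ) / N) ((j + 1) / N - z)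
      refine Set.mem_biUnion (Finset.mem_coe.2 (Finset.mem_filter.2 ⟨hmemj, w, z, ?_, ?_, hgw⟩))
        ⟨hj1'.le, hj2'.le⟩
      · exact ⟨by linarith [hw'.1], by linarith [hw'.2]⟩
      · exact ⟨hj1'.le, hj2'.le⟩
    calc volume (D ∩ Set.Ioo (-K : ℝ) K)
        ≤ volume (⋃ i ∈ B, Set.Icc ((i : ℝ) / N) ((i + 1) / N)) +
          volume (Set.range fun i : ℤ => (i : ℝ) / N) :=
          (measure_mono hcover).trans (measure_union_le _ _)
      _ = volume (⋃ i ∈ B, Set.Icc ((i : ℝ) / N) ((i + 1) / N)) := by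
          rw [(Set.countable_range _).measure_zero, add_zero]
      _ ≤ ∑ i ∈ B, volume (Set.Icc ((i : ℝ) / N) ((i + 1) / N)) := measure_biUnion_finset_le _ _
      _ = ∑ i ∈ B, ENNReal.ofReal (1 / N) := by
          refine Finset.sum_congr rfl fun i _ => ?_
          rw [Real.volume_Icc]; congr 1; ring
      _ = ENNReal.ofReal (B.card * (1 / N)) := by
          rw [Finset.sum_const, nsmul_eq_mul, ENNReal.ofReal_mul (Nat.cast_nonneg _),
            ENNReal.ofReal_natCast]
      _ ≤ η := by
          rw [← ENNReal.ofReal_coe_nnreal]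
          refine ENNReal.ofReal_le_ofReal ?_
          rw [mul_one_div, div_le_iff₀ hNr]
          nlinarith
  rw [ae_iff]
  change volume D = 0
  refine measure_mono_null (t := ⋃ K : ℕ, D ∩ Set.Ioo (-K : ℝ) K) (fun z hz => ?_)
    (measure_iUnion_null hK)
  obtain ⟨K, hKz⟩ := exists_nat_gt |z|
  exact Set.mem_iUnion.2 ⟨K, hz, abs_lt.1 hKz⟩

theorem SmallOscillationSums.boundedAEContinuous {g : ℝ → ℝ} (hg : SmallOscillationSums g) :
    BoundedAEContinuous g := by
  refine ⟨hg.locallyBoundedFun, ?_⟩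
  have h : ∀ᵐ x, ∀ p : ℕ, ∃ δ > 0, ∀ y, |y - x| < δ → |g y - g x| < 1 / ((p : ℝ) + 1) :=
    ae_all_iff.2 fun p => hg.ae_oscillation_lt (by positivity)
  filter_upwards [h] with x hx
  rw [Metric.continuousAt_iff]
  intro ε hε
  obtain ⟨p, hp⟩ := exists_nat_one_div_lt hε
  obtain ⟨δ, hδ, hy⟩ := hx p
  exact ⟨δ, hδ, fun {y} h => (hy y h).trans hp⟩

theorem locallyRiemannIntegrable_iff_boundedAEContinuous {g : ℝ → ℝ} :
    LocallyRiemannIntegrable g ↔ BoundedAEContinuous g :=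
  ⟨fun h => h.smallOscillationSums.boundedAEContinuous, fun h => h.locallyRiemannIntegrable⟩

/-! ### The difference property for Riemann integrable functions -/

theorem BoundedAEContinuous.sub {f g : ℝ → ℝ} (hf : BoundedAEContinuous f)
    (hg : BoundedAEContinuous g) : BoundedAEContinuous (fun x => f x - g x) :=
  ⟨hf.bounded.sub hg.bounded, by
    filter_upwards [hf.ae_continuousAt, hg.ae_continuousAt] with x h1 h2 using h1.sub h2⟩

theorem Continuous.boundedAEContinuous {g : ℝ → ℝ} (hg : Continuous g) :
    BoundedAEContinuous g :=
  ⟨hg.locallyBoundedFun, Eventually.of_forall fun _ => hg.continuousAt⟩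

theorem BoundedAEContinuous.comp_add_right {g : ℝ → ℝ} (hg : BoundedAEContinuous g) (h : ℝ) :
    BoundedAEContinuous (fun x => g (x + h)) := by
  refine ⟨fun K => ?_, ?_⟩
  · obtain ⟨M, hM⟩ := hg.bounded (K + |h|)
    exact ⟨M, fun x hx => hM _ ((abs_add_le _ _).trans (by linarith))⟩
  · have h1 := (measurePreserving_add_right (volume : Measure ℝ) h).quasiMeasurePreserving.ae
      hg.ae_continuousAt
    filter_upwards [h1] with x hx
    exact ContinuousAt.comp (f := fun x => x + h) hx (by fun_prop)

theorem BoundedAEContinuous.forwardDiff {g : ℝ → ℝ} (hg : BoundedAEContinuous g) (h : ℝ) :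
    BoundedAEContinuous (fwdDiff h g) :=
  (hg.comp_add_right h).sub hg

theorem BoundedAEContinuous.aestronglyMeasurable {g : ℝ → ℝ} (hg : BoundedAEContinuous g) :
    AEStronglyMeasurable g volume := by
  have hC : MeasurableSet {x | ContinuousAt g x} := measurableSet_of_continuousAt g
  have h := ContinuousOn.aestronglyMeasurable (μ := volume) (f := g) (s := {x | ContinuousAt g x})
    (fun x hx => ContinuousAt.continuousWithinAt hx) hC
  have hres : (volume : Measure ℝ).restrict {x | ContinuousAt g x} = volume :=
    Measure.restrict_eq_self_of_ae_mem hg.ae_continuousAt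
  rwa [hres] at h

theorem BoundedAEContinuous.intervalIntegrable {g : ℝ → ℝ} (hg : BoundedAEContinuous g)
    (a b : ℝ) : IntervalIntegrable g volume a b := by
  obtain ⟨M, hM⟩ := hg.bounded (max |a| |b|)
  refine (intervalIntegrable_const (c := M)).mono_fun' hg.aestronglyMeasurable.restrict ?_
  refine (ae_restrict_mem measurableSet_uIoc).mono fun x hx => hM x ?_
  have hx' := Set.uIoc_subset_uIcc hx
  rw [Set.mem_uIcc] at hx'
  rcases hx' with h | h
  · exact abs_le_max_abs_abs h.1 h.2
  · rw [max_comm]; exact abs_le_max_abs_abs h.1 h.2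

theorem BoundedAEContinuous.continuous_integral_translate {g : ℝ → ℝ}
    (hg : BoundedAEContinuous g) (a b : ℝ) :
    Continuous fun x => ∫ t in (a + x)..(b + x), g t := by
  have h := intervalIntegral.continuous_primitive hg.intervalIntegrable 0
  have h2 : (fun x => ∫ t in (a + x)..(b + x), g t) =
      fun x => (∫ t in 0..(b + x), g t) - ∫ t in 0..(a + x), g t := by
    funext x
    exact (intervalIntegral.integral_interval_sub_left (hg.intervalIntegrable _ _)
      (hg.intervalIntegrable _ _)).symm
  rw [h2]
  exact (h.comp (continuous_const.add continuous_id)).sub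
    (h.comp (continuous_const.add continuous_id))

theorem BoundedAEContinuous.integral_fwdDiff {g : ℝ → ℝ} (hg : BoundedAEContinuous g)
    (x a b : ℝ) : ∫ t in a..b, fwdDiff x g t =
      (∫ t in (a + x)..(b + x), g t) - ∫ t in a..b, g t := by
  simp only [fwdDiff]
  rw [intervalIntegral.integral_sub ((hg.comp_add_right x).intervalIntegrable _ _)
    (hg.intervalIntegrable _ _), intervalIntegral.integral_comp_add_right]

theorem fwdDiff_comm_apply (g : ℝ → ℝ) (s x t : ℝ) :
    fwdDiff s (fwdDiff x g) t = fwdDiff x (fwdDiff s g) t := by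
  simp only [fwdDiff, add_right_comm t s x]; ring

/-- If `x ↦ ∫_0^1 Δ_x g` is continuous, then so is `x ↦ ∫_J Δ_x g` for each interval `J` of
length `1 / n`: a translation of `J` changes this function by a continuous one, and `[0, 1]` is
made of `n` translates of `J`. -/
theorem continuous_integral_fwdDiff {g : ℝ → ℝ} (hg : ∀ h, BoundedAEContinuous (fwdDiff h g))
    (h0 : Continuous fun x => ∫ t in (0 : ℝ)..1, fwdDiff x g t) (a : ℝ) {n : ℕ} (hn : 0 < n) :
    Continuous fun x => ∫ t in a..(a + 1 / n), fwdDiff x g t := by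
  have hnr : (0 : ℝ) < n := by exact_mod_cast hn
  have hshift : ∀ s : ℝ, Continuous fun x => (∫ t in s..(s + 1 / n), fwdDiff x g t) -
      ∫ t in (0 : ℝ)..(1 / n), fwdDiff x g t := by
    intro s
    have h : ∀ x, (∫ t in s..(s + 1 / n), fwdDiff x g t) -
        ∫ t in (0 : ℝ)..(1 / n), fwdDiff x g t =
        (∫ t in (0 + x)..(1 / n + x), fwdDiff s g t) - ∫ t in (0 : ℝ)..(1 / n), fwdDiff s g t := by
      intro x
      rw [← (hg s).integral_fwdDiff, funext fun t => (fwdDiff_comm_apply g s x t).symm,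
        (hg x).integral_fwdDiff, zero_add, add_comm s]
    simp only [h]
    exact ((hg s).continuous_integral_translate 0 _).sub continuous_const
  have hbase : Continuous fun x => ∫ t in (0 : ℝ)..(1 / n), fwdDiff x g t := by
    have hsum : ∀ x, ∫ t in (0 : ℝ)..1, fwdDiff x g t =
        n * (∫ t in (0 : ℝ)..(1 / n), fwdDiff x g t) +
        ∑ i ∈ Finset.range n, ((∫ t in ((i : ℝ) / n)..((i : ℝ) / n + 1 / n), fwdDiff x g t) -
          ∫ t in (0 : ℝ)..(1 / n), fwdDiff x g t) := by
      intro x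
      have h := intervalIntegral.sum_integral_adjacent_intervals (f := fwdDiff x g)
        (μ := volume) (n := n) (a := fun i : ℕ => (i : ℝ) / n)
        fun i _ => (hg x).intervalIntegrable _ _
      simp only [CharP.cast_eq_zero, zero_div, div_self hnr.ne', Nat.cast_add, Nat.cast_one,
        add_div] at h
      rw [Finset.sum_sub_distrib, h, Finset.sum_const, Finset.card_range, nsmul_eq_mul]
      ring
    have heq : (fun x => ∫ t in (0 : ℝ)..(1 / n), fwdDiff x g t) = fun x =>
        (1 / n : ℝ) * ((∫ t in (0 : ℝ)..1, fwdDiff x g t) -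
        ∑ i ∈ Finset.range n, ((∫ t in ((i : ℝ) / n)..((i : ℝ) / n + 1 / n), fwdDiff x g t) -
          ∫ t in (0 : ℝ)..(1 / n), fwdDiff x g t)) := by
      funext x
      rw [hsum x, add_sub_cancel_right, one_div, inv_mul_cancel_left₀ hnr.ne']
    rw [heq]
    exact continuous_const.mul (h0.sub (continuous_finsetSum _ fun i _ => hshift _))
  refine ((hshift a).add hbase).congr fun x => ?_
  simp

/-- Transfer of variation bounds from the differences of `g` to `g` itself.
Suppose that each difference `Δ_h g` satisfies, for some `m`, the bounds
`∑ |Δ_h g (x i) - Δ_h g (y i)| ≤ B m ω` on a class `P m` of families of pairs of points.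
By Baire's theorem one `m` works for a set of `h` that is dense in an interval, hence, the sums
being continuous at almost every `h` as functions of `h`, for almost every `h` in an interval `J`.
Averaging over `J` bounds the sums of `g`, up to those of the averages `x ↦ ∫_J Δ_x g`. -/
theorem exists_sum_abs_sub_le_of_fwdDiff {g : ℝ → ℝ}
    (hg : ∀ h, BoundedAEContinuous (fwdDiff h g)) {Ω ι : Type*} (s : Ω → Finset ι)
    (x y : Ω → ι → ℝ) (P : ℕ → Ω → Prop) (B : ℕ → Ω → ℝ)
    (H : ∀ h, ∃ m, ∀ ω, P m ω →
      ∑ i ∈ s ω, |fwdDiff h g (x ω i) - fwdDiff h g (y ω i)| ≤ B m ω) :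
    ∃ m : ℕ, ∃ a : ℝ, ∃ n : ℕ, 0 < n ∧ ∀ ω, P m ω →
      ∑ i ∈ s ω, |g (x ω i) - g (y ω i)| ≤ B m ω +
        n * ∑ i ∈ s ω, |(∫ t in a..(a + 1 / n), fwdDiff (x ω i) g t) -
          ∫ t in a..(a + 1 / n), fwdDiff (y ω i) g t| := by
  let S : ℕ → Set ℝ := fun m => {h | ∀ ω, P m ω →
    ∑ i ∈ s ω, |fwdDiff h g (x ω i) - fwdDiff h g (y ω i)| ≤ B m ω}
  have hcover : ⋃ m, closure (S m) = Set.univ := by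
    refine Set.eq_univ_of_forall fun h => ?_
    obtain ⟨m, hm⟩ := H h
    exact Set.mem_iUnion.2 ⟨m, subset_closure hm⟩
  obtain ⟨m, a, ha⟩ := nonempty_interior_of_iUnion_of_closed (fun m => isClosed_closure) hcover
  obtain ⟨r, hr, hball⟩ := Metric.isOpen_iff.1 isOpen_interior a ha
  obtain ⟨n, hn⟩ := exists_nat_one_div_lt hr
  have hnr : (0 : ℝ) < ((n + 1 : ℕ) : ℝ) := by positivity
  refine ⟨m, a, n + 1, n.succ_pos, fun ω hω => ?_⟩
  set b : ℝ := a + 1 / ((n + 1 : ℕ) : ℝ) with hb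
  have hab : a ≤ b := by
    have : 0 ≤ 1 / ((n + 1 : ℕ) : ℝ) := by positivity
    linarith
  have hJ : ∀ t ∈ Set.Icc a b, t ∈ closure (S m) := fun t ht => interior_subset (hball (by
    rw [Metric.mem_ball, Real.dist_eq, abs_of_nonneg (by linarith [ht.1])]
    have := ht.2
    push_cast at hb
    linarith))
  let G : ι → ℝ → ℝ := fun i t =>
    fwdDiff (x ω i) g t - fwdDiff (y ω i) g t - (g (x ω i) - g (y ω i))
  have hG : ∀ i, BoundedAEContinuous (G i) := fun i =>
    ((hg _).sub (hg _)).sub (continuous_const.boundedAEContinuous)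
  have hGabs : ∀ i, IntervalIntegrable (fun t => |G i t|) volume a b := fun i =>
    ((hG i).intervalIntegrable a b).abs
  have hGeq : ∀ i t, fwdDiff t g (x ω i) - fwdDiff t g (y ω i) = G i t := fun i t => by
    simp only [G, fwdDiff, add_comm t]; ring
  have hae : ∀ᵐ t, t ∈ Set.Icc a b → ∑ i ∈ s ω, |G i t| ≤ B m ω := by
    have hcont : ∀ᵐ t, ∀ i ∈ s ω, ContinuousAt (G i) t :=
      (ae_ball_iff (s ω).countable_toSet).2 fun i _ => (hG i).ae_continuousAt
    filter_upwards [hcont] with t ht htJ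
    have hc : ContinuousAt (fun t => ∑ i ∈ s ω, |G i t|) t :=
      tendsto_finsetSum _ fun i hi => (ht i hi).abs
    by_contra! hlt
    obtain ⟨t', h1, h2⟩ := ((mem_closure_iff_frequently.1 (hJ t htJ)).and_eventually
      (hc.eventually (lt_mem_nhds hlt))).exists
    have h3 := h1 ω hω
    simp only [hGeq] at h3
    exact absurd h3 (not_le.2 h2)
  have hlen : b - a = 1 / ((n + 1 : ℕ) : ℝ) := by rw [hb]; ring
  have hint : ∑ i ∈ s ω, |∫ t in a..b, G i t| ≤ B m ω * (1 / ((n + 1 : ℕ) : ℝ)) := by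
    calc ∑ i ∈ s ω, |∫ t in a..b, G i t| ≤ ∑ i ∈ s ω, ∫ t in a..b, |G i t| :=
          Finset.sum_le_sum fun i _ => intervalIntegral.abs_integral_le_integral_abs hab
      _ = ∫ t in a..b, ∑ i ∈ s ω, |G i t| :=
          (intervalIntegral.integral_finsetSum fun i _ => hGabs i).symm
      _ ≤ ∫ t in a..b, B m ω := by
          refine intervalIntegral.integral_mono_ae_restrict hab
            (by simpa only [Finset.sum_fn] using IntervalIntegrable.sum (s ω) fun i _ => hGabs i)
            intervalIntegrable_const ?_
          exact (ae_restrict_iff' measurableSet_Icc).2 hae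
      _ = B m ω * (1 / ((n + 1 : ℕ) : ℝ)) := by
          rw [intervalIntegral.integral_const, hlen, smul_eq_mul, mul_comm]
  have hterm : ∀ i, |g (x ω i) - g (y ω i)| ≤ ((n + 1 : ℕ) : ℝ) * |∫ t in a..b, G i t| +
      ((n + 1 : ℕ) : ℝ) * |(∫ t in a..b, fwdDiff (x ω i) g t) -
        ∫ t in a..b, fwdDiff (y ω i) g t| := by
    intro i
    have hI : ∫ t in a..b, G i t = (∫ t in a..b, fwdDiff (x ω i) g t) -
        (∫ t in a..b, fwdDiff (y ω i) g t) -
        (1 / ((n + 1 : ℕ) : ℝ)) * (g (x ω i) - g (y ω i)) := by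
      simp only [G]
      rw [intervalIntegral.integral_sub (((hg _).intervalIntegrable _ _).sub
        ((hg _).intervalIntegrable _ _)) intervalIntegrable_const,
        intervalIntegral.integral_sub ((hg _).intervalIntegrable _ _)
        ((hg _).intervalIntegrable _ _), intervalIntegral.integral_const, hlen, smul_eq_mul]
    rw [← mul_add, ← div_le_iff₀' hnr, div_eq_inv_mul, ← one_div,
      ← abs_of_pos (one_div_pos.2 hnr), ← abs_mul]
    rw [hI]
    set u := ∫ t in a..b, fwdDiff (x ω i) g t
    set v := ∫ t in a..b, fwdDiff (y ω i) g t
    set w := (1 / ((n + 1 : ℕ) : ℝ)) * (g (x ω i) - g (y ω i))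
    have := abs_sub (u - v) (u - v - w)
    rw [sub_sub_cancel] at this
    linarith
  calc ∑ i ∈ s ω, |g (x ω i) - g (y ω i)| ≤ _ := Finset.sum_le_sum fun i _ => hterm i
    _ ≤ _ := by
      rw [Finset.sum_add_distrib, ← Finset.mul_sum, ← Finset.mul_sum]
      gcongr
      calc ((n + 1 : ℕ) : ℝ) * ∑ i ∈ s ω, |∫ t in a..b, G i t|
          ≤ ((n + 1 : ℕ) : ℝ) * (B m ω * (1 / ((n + 1 : ℕ) : ℝ))) := by gcongr
        _ = B m ω := by field_simp

/-- If the differences of `g` are Riemann integrable and `x ↦ ∫_0^1 Δ_x g` is continuous, then `g`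
is Riemann integrable. -/
theorem boundedAEContinuous_of_fwdDiff {g : ℝ → ℝ} (hg : ∀ h, BoundedAEContinuous (fwdDiff h g))
    (h0 : Continuous fun x => ∫ t in (0 : ℝ)..1, fwdDiff x g t) : BoundedAEContinuous g := by
  refine SmallOscillationSums.boundedAEContinuous fun K ε hε => ?_
  obtain ⟨m, a, n, hn, hmain⟩ := exists_sum_abs_sub_le_of_fwdDiff hg
    (Ω := ℕ × (ℤ → ℝ) × (ℤ → ℝ)) (fun ω => Finset.Ico (-(K * ω.1) : ℤ) (K * ω.1))
    (fun ω => ω.2.1) (fun ω => ω.2.2)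
    (fun m ω => m ≤ ω.1 ∧ 0 < ω.1 ∧
      (∀ i : ℤ, ω.2.1 i ∈ Set.Icc ((i : ℝ) / ω.1) ((i + 1) / ω.1)) ∧
      (∀ i : ℤ, ω.2.2 i ∈ Set.Icc ((i : ℝ) / ω.1) ((i + 1) / ω.1)))
    (fun _ ω => ε / 2 * ω.1) (fun h => by
      obtain ⟨N₀, hN₀⟩ :=
        (hg h).locallyRiemannIntegrable.smallOscillationSums K (ε / 2) (half_pos hε)
      exact ⟨N₀, fun ω hω => hN₀ ω.1 hω.1 hω.2.1 _ _ hω.2.2.1 hω.2.2.2⟩)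
  have hE := continuous_integral_fwdDiff hg h0 a hn
  set E : ℝ → ℝ := fun x => ∫ t in a..(a + 1 / n), fwdDiff x g t with hEdef
  have hnr : (0 : ℝ) < n := by exact_mod_cast hn
  have huc := (isCompact_Icc (a := -(K : ℝ)) (b := K)).uniformContinuousOn_of_continuous
    hE.continuousOn
  obtain ⟨δ, hδ, hEδ⟩ := Metric.uniformContinuousOn_iff_le.1 huc (ε / (4 * n * (K + 1)))
    (by positivity)
  obtain ⟨N₁, hN₁⟩ := exists_nat_gt (1 / δ)
  refine ⟨max m N₁, fun N hN hNpos x y hx hy => ?_⟩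
  have hNr : (0 : ℝ) < N := by exact_mod_cast hNpos
  refine (hmain (N, x, y) ⟨(le_max_left _ _).trans hN, hNpos, hx, hy⟩).trans ?_
  have hcellK : ∀ i ∈ Finset.Ico (-(K * N) : ℤ) (K * N), ∀ z : ℝ,
      z ∈ Set.Icc ((i : ℝ) / N) ((i + 1) / N) → z ∈ Set.Icc (-(K : ℝ)) K := by
    intro i hi z hz
    rw [Finset.mem_Ico] at hi
    have h1 : ((-(K * N) : ℤ) : ℝ) ≤ i := by exact_mod_cast hi.1
    have h2 : ((i + 1 : ℤ) : ℝ) ≤ ((K * N : ℤ) : ℝ) := by exact_mod_cast hi.2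
    push_cast at h1 h2
    refine ⟨le_trans ?_ hz.1, hz.2.trans ?_⟩
    · rw [le_div_iff₀ hNr]; linarith
    · rw [div_le_iff₀ hNr]; linarith
  have hterm : ∀ i ∈ Finset.Ico (-(K * N) : ℤ) (K * N),
      |E (x i) - E (y i)| ≤ ε / (4 * n * (K + 1)) := by
    intro i hi
    refine hEδ _ (hcellK i hi _ (hx i)) _ (hcellK i hi _ (hy i)) ?_
    refine (Real.dist_le_of_mem_Icc (hx i) (hy i)).trans ?_
    rw [← sub_div, add_sub_cancel_left, div_le_iff₀ hNr, mul_comm, ← div_le_iff₀ hδ]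
    exact hN₁.le.trans (by exact_mod_cast (le_max_right _ _).trans hN)
  have hsum := Finset.sum_le_card_nsmul _ _ _ hterm
  have hcard : ((Finset.Ico (-(K * N) : ℤ) (K * N)).card : ℝ) = 2 * K * N := by
    rw [Int.card_Ico, show (K * N - -(K * N) : ℤ) = ((2 * K * N : ℕ) : ℤ) by push_cast; ring,
      Int.toNat_natCast]
    push_cast; ring
  rw [nsmul_eq_mul, hcard] at hsum
  calc ε / 2 * N + n * ∑ i ∈ Finset.Ico (-(K * N) : ℤ) (K * N), |E (x i) - E (y i)|
      ≤ ε / 2 * N + n * (2 * K * N * (ε / (4 * n * (K + 1)))) := by gcongr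
    _ = ε / 2 * N + ε / 2 * N * (K / (K + 1)) := by field_simp; ring
    _ ≤ ε / 2 * N + ε / 2 * N * 1 := by
        gcongr
        rw [div_le_one (by positivity)]
        linarith
    _ = ε * N := by ring

/-- **De Bruijn's difference property** for Riemann integrable functions.
The additive part is `h ↦ ∫_0^1 Δ_h f - ∫_0^h Δ_1 f`, which would be zero if `f` itself were
integrable. -/
theorem exists_additive_add_boundedAEContinuous {f : ℝ → ℝ}
    (hf : ∀ h, BoundedAEContinuous (fwdDiff h f)) :
    ∃ (A : ℝ →+ ℝ) (g : ℝ → ℝ), BoundedAEContinuous g ∧ ∀ x, f x = A x + g x := by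
  let A : ℝ → ℝ := fun h => (∫ t in (0 : ℝ)..1, fwdDiff h f t) - ∫ t in (0 : ℝ)..h, fwdDiff 1 f t
  have hadd : ∀ h k, A (h + k) = A h + A k := by
    intro h k
    have h1 : ∫ t in (0 : ℝ)..1, fwdDiff (h + k) f t =
        (∫ t in (0 : ℝ)..1, fwdDiff h f (t + k)) + ∫ t in (0 : ℝ)..1, fwdDiff k f t := by
      rw [← intervalIntegral.integral_add (((hf h).comp_add_right k).intervalIntegrable _ _)
        ((hf k).intervalIntegrable _ _)]
      refine intervalIntegral.integral_congr fun t _ => ?_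
      simp only [fwdDiff, add_comm h k, ← add_assoc]; ring
    have h2 : (∫ t in (0 : ℝ)..1, fwdDiff h f (t + k)) - ∫ t in (0 : ℝ)..1, fwdDiff h f t =
        ∫ t in (0 : ℝ)..k, fwdDiff 1 (fwdDiff h f) t := by
      rw [(hf h).integral_fwdDiff, intervalIntegral.integral_comp_add_right, zero_add, zero_add,
        add_comm k 1]
      have e1 := intervalIntegral.integral_interval_sub_interval_comm
        ((hf h).intervalIntegrable k (1 + k)) ((hf h).intervalIntegrable 0 1)
        ((hf h).intervalIntegrable k 0)
      have e2 := intervalIntegral.integral_symm (f := fwdDiff h f) (μ := volume) 0 k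
      have e3 := intervalIntegral.integral_symm (f := fwdDiff h f) (μ := volume) 1 (1 + k)
      linarith
    have h3 : ∫ t in (0 : ℝ)..k, fwdDiff 1 (fwdDiff h f) t =
        (∫ t in h..(h + k), fwdDiff 1 f t) - ∫ t in (0 : ℝ)..k, fwdDiff 1 f t := by
      rw [funext fun t => fwdDiff_comm_apply f 1 h t, (hf 1).integral_fwdDiff, zero_add,
        add_comm k h]
    have h4 := intervalIntegral.integral_add_adjacent_intervals
      ((hf 1).intervalIntegrable 0 h) ((hf 1).intervalIntegrable h (h + k))
    simp only [A]
    linarith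
  have hA1 : A 1 = 0 := sub_self _
  refine ⟨AddMonoidHom.mk' A hadd, fun x => f x - A x, ?_, fun x => by simp⟩
  have hdiff : ∀ h, fwdDiff h (fun x => f x - A x) = fun x => fwdDiff h f x - A h := by
    intro h; funext x; simp only [fwdDiff, hadd]; ring
  refine boundedAEContinuous_of_fwdDiff (fun h => ?_) ?_
  · rw [hdiff]
    exact (hf h).sub continuous_const.boundedAEContinuous
  · have heq : (fun x => ∫ t in (0 : ℝ)..1, fwdDiff x (fun x => f x - A x) t) =
        fun x => ∫ t in (0 : ℝ)..x, fwdDiff 1 f t := by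
      funext x
      rw [hdiff, intervalIntegral.integral_sub ((hf x).intervalIntegrable _ _)
        intervalIntegrable_const, intervalIntegral.integral_const]
      simp only [A, sub_zero, one_smul]
      ring
    rw [heq]
    exact intervalIntegral.continuous_primitive (hf 1).intervalIntegrable 0

/-! ### Bounded variation and absolute continuity -/

theorem locallyBoundedVariationOn_univ_iff {f : ℝ → ℝ} :
    LocallyBoundedVariationOn f Set.univ ↔ ∀ a b : ℝ, ∃ C : ℝ, ∀ (p : ℕ) (u : ℕ → ℝ), Monotone u →
      (∀ i, u i ∈ Set.Icc a b) → ∑ i ∈ Finset.range p, |f (u (i + 1)) - f (u i)| ≤ C := by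
  have hsum : ∀ (p : ℕ) (u : ℕ → ℝ), ∑ i ∈ Finset.range p, edist (f (u (i + 1))) (f (u i)) =
      ENNReal.ofReal (∑ i ∈ Finset.range p, |f (u (i + 1)) - f (u i)|) := fun p u => by
    rw [ENNReal.ofReal_sum_of_nonneg fun _ _ => abs_nonneg _]
    simp only [edist_dist, Real.dist_eq]
  constructor
  · intro h a b
    have hfin : eVariationOn f (Set.univ ∩ Set.Icc a b) ≠ ⊤ := h a b trivial trivial
    refine ⟨(eVariationOn f (Set.univ ∩ Set.Icc a b)).toReal, fun p u hu hmem => ?_⟩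
    rw [← ENNReal.ofReal_le_iff_le_toReal hfin, ← hsum]
    exact eVariationOn.sum_le hu fun i => ⟨trivial, hmem i⟩
  · intro h a b _ _
    obtain ⟨C, hC⟩ := h a b
    refine ne_top_of_le_ne_top (ENNReal.ofReal_ne_top (r := C)) (iSup_le fun ⟨p, u, hu, hmem⟩ => ?_)
    rw [hsum]
    exact ENNReal.ofReal_le_ofReal (hC p u hu fun i => (hmem i).2)

theorem locallyBoundedVariationOn_univ_sub {f g : ℝ → ℝ}
    (hf : LocallyBoundedVariationOn f Set.univ) (hg : LocallyBoundedVariationOn g Set.univ) :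
    LocallyBoundedVariationOn (fun x => f x - g x) Set.univ := by
  rw [locallyBoundedVariationOn_univ_iff] at *
  intro a b
  obtain ⟨C, hC⟩ := hf a b
  obtain ⟨D, hD⟩ := hg a b
  refine ⟨C + D, fun p u hu hmem => ?_⟩
  refine le_trans ?_ (add_le_add (hC p u hu hmem) (hD p u hu hmem))
  rw [← Finset.sum_add_distrib]
  refine Finset.sum_le_sum fun i _ => ?_
  rw [sub_sub_sub_comm]
  exact abs_sub _ _

theorem locallyBoundedVariationOn_univ_const (c : ℝ) :
    LocallyBoundedVariationOn (fun _ : ℝ => c) Set.univ :=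
  locallyBoundedVariationOn_univ_iff.2 fun _ _ => ⟨0, by simp⟩

theorem locallyBoundedVariationOn_univ_comp_add_right {f : ℝ → ℝ}
    (hf : LocallyBoundedVariationOn f Set.univ) (h : ℝ) :
    LocallyBoundedVariationOn (fun x => f (x + h)) Set.univ := by
  rw [locallyBoundedVariationOn_univ_iff] at *
  intro a b
  obtain ⟨C, hC⟩ := hf (a + h) (b + h)
  exact ⟨C, fun p u hu hmem => hC p (fun i => u i + h) (fun i j hij => by simpa using hu hij)
    fun i => ⟨by linarith [(hmem i).1], by linarith [(hmem i).2]⟩⟩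

theorem LocallyBoundedVariationOn.boundedAEContinuous {f : ℝ → ℝ}
    (hf : LocallyBoundedVariationOn f Set.univ) : BoundedAEContinuous f := by
  refine ⟨fun K => ?_, hf.ae_differentiableAt.mono fun x hx => hx.continuousAt⟩
  obtain ⟨C, hC⟩ := locallyBoundedVariationOn_univ_iff.1 hf (-|K|) |K|
  refine ⟨C + |f (-|K|)|, fun x hx => ?_⟩
  have hx' := abs_le.1 (hx.trans (le_abs_self K))
  have h1 := hC 1 (fun i => if i = 0 then -|K| else x)
    (fun i j hij => by
      by_cases hj : j = 0
      · have hi : i = 0 := by omega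
        simp [hi, hj]
      · by_cases hi : i = 0
        · simpa [hi, hj] using hx'.1
        · simp [hi, hj])
    (fun i => by
      split_ifs
      · exact ⟨le_rfl, by linarith [abs_nonneg K]⟩
      · exact hx')
  simp only [Finset.range_one, Finset.sum_singleton, zero_add, one_ne_zero, if_false,
    if_true] at h1
  have h2 := abs_add_le (f x - f (-|K|)) (f (-|K|))
  rw [sub_add_cancel] at h2
  linarith

theorem LocallyAbsolutelyContinuous.continuous {f : ℝ → ℝ} (hf : LocallyAbsolutelyContinuous f) :
    Continuous f := by
  refine continuous_iff_continuousAt.2 fun x => ?_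
  have h := (hf (x - 1) (x + 1) (by linarith)).continuousOn
  rw [Set.uIcc_of_le (by linarith)] at h
  exact h.continuousAt (Icc_mem_nhds (by linarith) (by linarith))

theorem LocallyAbsolutelyContinuous.sub {f g : ℝ → ℝ} (hf : LocallyAbsolutelyContinuous f)
    (hg : LocallyAbsolutelyContinuous g) : LocallyAbsolutelyContinuous (fun x => f x - g x) :=
  fun a b hab => (hf a b hab).sub (hg a b hab)

theorem locallyAbsolutelyContinuous_const (c : ℝ) :
    LocallyAbsolutelyContinuous (fun _ : ℝ => c) := fun a b _ =>
  (absolutelyContinuousOnInterval_iff _ a b).2 fun ε hε => ⟨1, one_pos, fun _ _ _ => by simpa⟩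

theorem LocallyAbsolutelyContinuous.comp_add_right {f : ℝ → ℝ}
    (hf : LocallyAbsolutelyContinuous f) (h : ℝ) :
    LocallyAbsolutelyContinuous (fun x => f (x + h)) := by
  intro a b hab
  rw [absolutelyContinuousOnInterval_iff]
  intro ε hε
  obtain ⟨δ, hδ, H⟩ := (absolutelyContinuousOnInterval_iff _ _ _).1
    (hf (a + h) (b + h) (by linarith)) ε hε
  refine ⟨δ, hδ, fun E hE hsum => H (E.1, fun i => ((E.2 i).1 + h, (E.2 i).2 + h)) ?_ (by simpa)⟩
  obtain ⟨h1, h2⟩ := hE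
  refine ⟨fun i hi => ?_, fun i hi j hj hij => ?_⟩
  · have := h1 i hi
    rw [Set.uIcc_of_le hab] at this
    rw [Set.uIcc_of_le (by linarith)]
    exact ⟨⟨by linarith [this.1.1], by linarith [this.1.2]⟩,
      ⟨by linarith [this.2.1], by linarith [this.2.2]⟩⟩
  · have := h2 hi hj hij
    simp only [Function.onFun, Set.disjoint_left, Set.mem_uIoc] at this ⊢
    intro z hz hz'
    refine this (a := z - h) ?_ ?_
    · rcases hz with hz | hz
      · left; constructor <;> linarith [hz.1, hz.2]
      · right; constructor <;> linarith [hz.1, hz.2]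
    · rcases hz' with hz | hz
      · left; constructor <;> linarith [hz.1, hz.2]
      · right; constructor <;> linarith [hz.1, hz.2]

/-- The averages `x ↦ ∫_a^b Δ_x g` of a Riemann integrable function are locally Lipschitz. -/
theorem BoundedAEContinuous.exists_abs_integral_fwdDiff_sub_le {g : ℝ → ℝ}
    (hg : BoundedAEContinuous g) (a b K : ℝ) : ∃ C : ℝ, 0 ≤ C ∧ ∀ x y, |x| ≤ K → |y| ≤ K →
      |(∫ t in a..b, fwdDiff x g t) - ∫ t in a..b, fwdDiff y g t| ≤ C * |x - y| := by
  obtain ⟨M, hM⟩ := hg.bounded (|a| + |b| + K)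
  have hbound : ∀ c, |c| ≤ |a| + |b| → ∀ x y, |x| ≤ K → |y| ≤ K →
      |∫ t in (c + y)..(c + x), g t| ≤ |M| * |x - y| := by
    intro c hc x y hx hy
    have h := intervalIntegral.norm_integral_le_of_norm_le_const (a := c + y) (b := c + x)
      (C := |M|) (f := g) fun t ht => by
        refine (hM t ?_).trans (le_abs_self M)
        have ht' := Set.uIoc_subset_uIcc ht
        rw [Set.mem_uIcc] at ht'
        have hc' := abs_le.1 hc
        have hx' := abs_le.1 hx
        have hy' := abs_le.1 hy
        rw [abs_le]
        rcases ht' with h | h <;> constructor <;> linarith [h.1, h.2]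
    rwa [add_sub_add_left_eq_sub] at h
  refine ⟨|M| + |M|, by positivity, fun x y hx hy => ?_⟩
  have hI := intervalIntegral.integral_interval_sub_interval_comm'
    (hg.intervalIntegrable (a + x) (b + x)) (hg.intervalIntegrable (a + y) (b + y))
    (hg.intervalIntegrable (a + x) (a + y))
  rw [hg.integral_fwdDiff, hg.integral_fwdDiff, sub_sub_sub_cancel_right, hI, add_mul]
  refine (abs_sub _ _).trans (add_le_add (hbound b ?_ x y hx hy) (hbound a ?_ x y hx hy))
  · linarith [abs_nonneg a]
  · linarith [abs_nonneg b]

theorem BoundedAEContinuous.locallyBoundedVariationOn_of_fwdDiff {g : ℝ → ℝ}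
    (hg : BoundedAEContinuous g)
    (h : ∀ h, LocallyBoundedVariationOn (fwdDiff h g) Set.univ) :
    LocallyBoundedVariationOn g Set.univ := by
  rw [locallyBoundedVariationOn_univ_iff]
  intro a b
  obtain ⟨m, c, n, -, hmain⟩ := exists_sum_abs_sub_le_of_fwdDiff hg.forwardDiff
    (Ω := ℕ × (ℕ → ℝ)) (fun ω => Finset.range ω.1) (fun ω i => ω.2 (i + 1)) (fun ω i => ω.2 i)
    (fun _ ω => Monotone ω.2 ∧ ∀ i, ω.2 i ∈ Set.Icc a b) (fun m _ => m) (fun k => by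
      obtain ⟨C, hC⟩ := locallyBoundedVariationOn_univ_iff.1 (h k) a b
      exact ⟨⌈C⌉₊, fun ω hω => (hC ω.1 ω.2 hω.1 hω.2).trans (Nat.le_ceil C)⟩)
  obtain ⟨C, hC0, hC⟩ := hg.exists_abs_integral_fwdDiff_sub_le c (c + 1 / n) (max |a| |b|)
  refine ⟨m + n * (C * (b - a)), fun p u hu hmem => (hmain (p, u) ⟨hu, hmem⟩).trans ?_⟩
  have hK : ∀ i, |u i| ≤ max |a| |b| := fun i => abs_le_max_abs_abs (hmem i).1 (hmem i).2
  gcongr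
  calc ∑ i ∈ Finset.range p, |(∫ t in c..(c + 1 / n), fwdDiff (u (i + 1)) g t) -
        ∫ t in c..(c + 1 / n), fwdDiff (u i) g t|
      ≤ ∑ i ∈ Finset.range p, C * (u (i + 1) - u i) := Finset.sum_le_sum fun i _ => by
        have := hC (u (i + 1)) (u i) (hK _) (hK _)
        rwa [abs_of_nonneg (sub_nonneg.2 (hu (Nat.le_succ i)))] at this
    _ = C * (u p - u 0) := by rw [← Finset.mul_sum, Finset.sum_range_sub]
    _ ≤ C * (b - a) := by gcongr; exacts [(hmem p).2, (hmem 0).1]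

theorem BoundedAEContinuous.locallyAbsolutelyContinuous_of_fwdDiff {g : ℝ → ℝ}
    (hg : BoundedAEContinuous g) (h : ∀ h, LocallyAbsolutelyContinuous (fwdDiff h g)) :
    LocallyAbsolutelyContinuous g := by
  intro a b hab
  rw [absolutelyContinuousOnInterval_iff]
  intro ε hε
  obtain ⟨m, c, n, -, hmain⟩ := exists_sum_abs_sub_le_of_fwdDiff hg.forwardDiff
    (Ω := ℕ × (ℕ → ℝ × ℝ)) (fun ω => Finset.range ω.1) (fun ω i => (ω.2 i).1)
    (fun ω i => (ω.2 i).2)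
    (fun m ω => ω ∈ AbsolutelyContinuousOnInterval.disjWithin a b ∧
      ∑ i ∈ Finset.range ω.1, dist (ω.2 i).1 (ω.2 i).2 < 1 / ((m : ℝ) + 1))
    (fun _ _ => ε / 2) (fun k => by
      obtain ⟨δ, hδ, hH⟩ := (absolutelyContinuousOnInterval_iff _ _ _).1 (h k a b hab) (ε / 2)
        (half_pos hε)
      obtain ⟨m, hm⟩ := exists_nat_one_div_lt hδ
      exact ⟨m, fun ω hω => (hH ω hω.1 (hω.2.trans hm)).le⟩)
  obtain ⟨C, hC0, hC⟩ := hg.exists_abs_integral_fwdDiff_sub_le c (c + 1 / n) (max |a| |b|)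
  refine ⟨min (1 / ((m : ℝ) + 1)) (ε / (2 * (n * C + 1))), lt_min (by positivity) (by positivity),
    fun ω hω hsum => ?_⟩
  refine (hmain ω ⟨hω, hsum.trans_le (min_le_left _ _)⟩).trans_lt ?_
  have hK : ∀ i ∈ Finset.range ω.1, |(ω.2 i).1| ≤ max |a| |b| ∧ |(ω.2 i).2| ≤ max |a| |b| := by
    intro i hi
    have := hω.1 i hi
    rw [Set.uIcc_of_le hab] at this
    exact ⟨abs_le_max_abs_abs this.1.1 this.1.2, abs_le_max_abs_abs this.2.1 this.2.2⟩
  have hle : ∑ i ∈ Finset.range ω.1, |(∫ t in c..(c + 1 / n), fwdDiff (ω.2 i).1 g t) -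
        ∫ t in c..(c + 1 / n), fwdDiff (ω.2 i).2 g t| ≤
      C * ∑ i ∈ Finset.range ω.1, dist (ω.2 i).1 (ω.2 i).2 := by
    rw [Finset.mul_sum]
    exact Finset.sum_le_sum fun i hi => hC _ _ (hK i hi).1 (hK i hi).2
  set σ := ∑ i ∈ Finset.range ω.1, dist (ω.2 i).1 (ω.2 i).2
  have hσ0 : 0 ≤ σ := Finset.sum_nonneg fun _ _ => dist_nonneg
  have hσ := hsum.trans_le (min_le_right _ _)
  rw [lt_div_iff₀ (by positivity)] at hσ
  calc ε / 2 + n * ∑ i ∈ Finset.range ω.1, |(∫ t in c..(c + 1 / n), fwdDiff (ω.2 i).1 g t) -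
        ∫ t in c..(c + 1 / n), fwdDiff (ω.2 i).2 g t| ≤ ε / 2 + n * (C * σ) := by gcongr
    _ < ε := by nlinarith

/-! ### Continuity and differentiability -/

theorem eq_comp_fwdDiff (g : ℝ → ℝ) (x : ℝ) :
    g = fun y => g (y + (-x)) + fwdDiff x g (y + (-x)) := by
  funext y; simp [fwdDiff]

theorem BoundedAEContinuous.continuous_of_fwdDiff {g : ℝ → ℝ} (hg : BoundedAEContinuous g)
    (h : ∀ h, Continuous (fwdDiff h g)) : Continuous g := by
  obtain ⟨x₀, hx₀⟩ := hg.ae_continuousAt.exists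
  refine continuous_iff_continuousAt.2 fun x => ?_
  rw [eq_comp_fwdDiff g (x - x₀)]
  have hshift : ContinuousAt (fun y : ℝ => y + (-(x - x₀))) x := by fun_prop
  refine ContinuousAt.add (ContinuousAt.comp (g := g) ?_ hshift)
    ((h _).continuousAt.comp hshift)
  simpa using hx₀

theorem continuous_of_measurable_of_fwdDiff {g : ℝ → ℝ} (hg : Measurable g)
    (h : ∀ h, Continuous (fwdDiff h g)) : Continuous g := by
  obtain ⟨A, k, hk, hgk⟩ := exists_additive_add_boundedAEContinuous
    fun h' => (h h').boundedAEContinuous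
  have hkc : Continuous k := hk.continuous_of_fwdDiff fun s => by
    have : fwdDiff s k = fun x => fwdDiff s g x - A s := by
      funext x; simp only [fwdDiff, hgk, map_add]; ring
    rw [this]
    exact (h s).sub continuous_const
  have hA : Measurable A := by
    have : (A : ℝ → ℝ) = fun x => g x - k x := by funext x; rw [hgk]; ring
    rw [this]
    exact hg.sub hkc.measurable
  have hAc : Continuous A := MeasureTheory.Measure.AddMonoidHom.continuous_of_measurable A hA
  rw [funext hgk]
  exact hAc.add hkc

/-- The difference quotient of `g` at `0` is the mean, over `k` in an interval, of a difference
quotient of `g` at `k` minus that of `Δ_k g` at `0`. The means of the former converge because `g`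
has a primitive; those of the latter converge by dominated convergence, on an interval where
Baire's theorem provides a uniform bound. -/
theorem differentiableAt_zero_of_fwdDiff {g : ℝ → ℝ} (hg : Continuous g)
    (h : ∀ h, DifferentiableAt ℝ (fwdDiff h g) 0) : DifferentiableAt ℝ g 0 := by
  let S : ℕ → Set ℝ := fun m => {k | ∀ t : ℝ, |t| ≤ 1 / ((m : ℝ) + 1) →
    |fwdDiff k g t - fwdDiff k g 0| ≤ m * |t|}
  have hclosed : ∀ m, IsClosed (S m) := fun m => by
    simp only [S, Set.ofPred_forall]
    refine isClosed_iInter fun t => isClosed_iInter fun _ => isClosed_le ?_ continuous_const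
    simp only [fwdDiff]
    fun_prop
  have hcover : ⋃ m, S m = Set.univ := by
    refine Set.eq_univ_of_forall fun k => ?_
    obtain ⟨C, hC⟩ := (h k).hasDerivAt.isBigO_sub.bound
    obtain ⟨δ, hδ, hball⟩ := Metric.eventually_nhds_iff.1 hC
    obtain ⟨m₁, hm₁⟩ := exists_nat_one_div_lt hδ
    refine Set.mem_iUnion.2 ⟨max m₁ ⌈C⌉₊, fun t ht => ?_⟩
    have h1 : 1 / (((max m₁ ⌈C⌉₊ : ℕ) : ℝ) + 1) ≤ 1 / ((m₁ : ℝ) + 1) := by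
      gcongr; exact le_max_left _ _
    have h2 := hball (y := t) (by rw [Real.dist_eq, sub_zero]; linarith)
    simp only [sub_zero, Real.norm_eq_abs] at h2
    refine h2.trans ?_
    gcongr
    exact (Nat.le_ceil C).trans (by exact_mod_cast le_max_right _ _)
  obtain ⟨m, c, hc⟩ := nonempty_interior_of_iUnion_of_closed hclosed hcover
  obtain ⟨r, hr, hball⟩ := Metric.isOpen_iff.1 isOpen_interior c hc
  obtain ⟨b, hb1, hb2⟩ := exists_between (show c < c + r by linarith)
  have hS : ∀ k ∈ Set.uIoc c b, k ∈ S m := fun k hk => interior_subset (hball (by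
    rw [Set.uIoc_of_le hb1.le] at hk
    rw [Metric.mem_ball, Real.dist_eq, abs_of_nonneg (by linarith [hk.1])]
    linarith [hk.2]))
  have hlim : Tendsto (fun t => ∫ k in c..b, slope (fwdDiff k g) 0 t) (𝓝[≠] 0)
      (𝓝 (∫ k in c..b, deriv (fwdDiff k g) 0)) := by
    refine intervalIntegral.tendsto_integral_filter_of_dominated_convergence (fun _ => (m : ℝ))
      (Eventually.of_forall fun t => ?_) ?_ intervalIntegrable_const ?_
    · refine Continuous.aestronglyMeasurable ?_
      simp only [slope_def_field, fwdDiff]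
      fun_prop
    · have hsmall : ∀ᶠ t : ℝ in 𝓝[≠] 0, |t| ≤ 1 / ((m : ℝ) + 1) ∧ t ≠ 0 := by
        refine ((eventually_nhdsWithin_of_eventually_nhds ?_).and self_mem_nhdsWithin)
        exact (continuous_abs.tendsto' (0 : ℝ) 0 abs_zero).eventually_le_const (by positivity)
      filter_upwards [hsmall] with t ht
      refine Eventually.of_forall fun k hk => ?_
      rw [slope_def_field, sub_zero, Real.norm_eq_abs, abs_div,
        div_le_iff₀ (abs_pos.2 ht.2)]
      exact hS k hk t ht.1
    · exact Eventually.of_forall fun k _ => hasDerivAt_iff_tendsto_slope.1 (h k).hasDerivAt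
  -- the function `Φ t = ∫_c^b g (k + t) dk` is differentiable
  have hΦ : HasDerivAt (fun t => (∫ k in (0 : ℝ)..(b + t), g k) - ∫ k in (0 : ℝ)..(c + t), g k)
      (g b - g c) 0 := by
    have hd : ∀ s, HasDerivAt (fun t => ∫ k in (0 : ℝ)..(s + t), g k) (g s) 0 := fun s => by
      have h1 := (hg.integral_hasStrictDerivAt 0 (s + 0)).hasDerivAt
      simpa using HasDerivAt.comp_const_add s 0 h1
    exact (hd b).sub (hd c)
  have hslope : ∀ t : ℝ, slope g 0 t = (b - c)⁻¹ *
      (slope (fun t => (∫ k in (0 : ℝ)..(b + t), g k) - ∫ k in (0 : ℝ)..(c + t), g k) 0 t -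
        ∫ k in c..b, slope (fwdDiff k g) 0 t) := by
    intro t
    have hbc : b - c ≠ 0 := by linarith
    have hint : ∀ x y, IntervalIntegrable g volume x y := fun x y => hg.intervalIntegrable x y
    have hI : ∫ k in c..b, slope (fwdDiff k g) 0 t =
        ((∫ k in (c + t)..(b + t), g k) - (∫ k in c..b, g k) - (b - c) * (g t - g 0)) / t := by
      have : ∀ k, slope (fwdDiff k g) 0 t = (g (k + t) - g k - (g t - g 0)) / t := fun k => by
        rw [slope_def_field, sub_zero]
        simp only [fwdDiff, zero_add, add_comm t k]
        ring
      simp only [this]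
      rw [intervalIntegral.integral_div, intervalIntegral.integral_sub, intervalIntegral.integral_sub,
        intervalIntegral.integral_comp_add_right, intervalIntegral.integral_const, smul_eq_mul]
      all_goals apply Continuous.intervalIntegrable; fun_prop
    have e1 := intervalIntegral.integral_interval_sub_left (hint 0 (b + t)) (hint 0 (c + t))
    have e2 := intervalIntegral.integral_interval_sub_left (hint 0 b) (hint 0 c)
    rw [hI, slope_def_field, slope_def_field, e1, add_zero, add_zero, e2, sub_zero]
    field_simp
    ring
  have hfinal : Tendsto (slope g 0) (𝓝[≠] 0)
      (𝓝 ((b - c)⁻¹ * (g b - g c - ∫ k in c..b, deriv (fwdDiff k g) 0))) := by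
    rw [funext hslope]
    exact ((hasDerivAt_iff_tendsto_slope.1 hΦ).sub hlim).const_mul _
  exact (hasDerivAt_iff_tendsto_slope.2 hfinal).differentiableAt

theorem differentiable_of_fwdDiff {g : ℝ → ℝ} (hg : Continuous g)
    (h : ∀ h, Differentiable ℝ (fwdDiff h g)) : Differentiable ℝ g := by
  have h0 := differentiableAt_zero_of_fwdDiff hg fun k => h k 0
  intro x
  rw [eq_comp_fwdDiff g x]
  refine DifferentiableAt.add ?_ ?_
  · refine DifferentiableAt.comp (g := g) x ?_ (by fun_prop)
    simpa using h0
  · exact (h x _).comp x (by fun_prop)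

theorem deriv_fwdDiff {g : ℝ → ℝ} (hg : Differentiable ℝ g) (h : ℝ) :
    deriv (fwdDiff h g) = fwdDiff h (deriv g) := by
  funext x
  have h1 : DifferentiableAt ℝ (fun y => g (y + h)) x :=
    (hg _).comp x (by fun_prop)
  change deriv (fun y => g (y + h) - g y) x = _
  rw [deriv_fun_sub h1 (hg x), deriv_comp_add_const]
  rfl

theorem contDiff_of_fwdDiff (k : ℕ) : ∀ {g : ℝ → ℝ}, Measurable g →
    (∀ h, ContDiff ℝ k (fwdDiff h g)) → ContDiff ℝ k g := by
  induction k with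
  | zero =>
    intro g hg h
    exact contDiff_zero.2 (continuous_of_measurable_of_fwdDiff hg fun s => (h s).continuous)
  | succ k ih =>
    intro g hg h
    have hd : Differentiable ℝ g := differentiable_of_fwdDiff
      (continuous_of_measurable_of_fwdDiff hg fun s => (h s).continuous)
      fun s => (h s).differentiable (by simp)
    rw [Nat.cast_add, Nat.cast_one, contDiff_succ_iff_deriv]
    refine ⟨hd, by simp, ih (measurable_deriv g) fun s => ?_⟩
    rw [← deriv_fwdDiff hd]
    have := h s
    rw [Nat.cast_add, Nat.cast_one, contDiff_succ_iff_deriv] at this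
    exact this.2.2

theorem isTimesDifferentiable_succ_iff {k : ℕ} {g : ℝ → ℝ} : IsTimesDifferentiable (k + 1) g ↔
    Differentiable ℝ g ∧ IsTimesDifferentiable k (deriv g) := by
  constructor
  · intro h
    refine ⟨by simpa using h 0 (Nat.succ_pos k), fun j hj => ?_⟩
    rw [← iteratedDeriv_succ']
    exact h (j + 1) (by omega)
  · rintro ⟨h0, h1⟩ j hj
    cases j with
    | zero => simpa using h0
    | succ j =>
      rw [iteratedDeriv_succ']
      exact h1 j (by omega)

theorem isTimesDifferentiable_of_fwdDiff (k : ℕ) : ∀ {g : ℝ → ℝ}, Measurable g →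
    (∀ h, IsTimesDifferentiable k (fwdDiff h g)) → IsTimesDifferentiable k g := by
  induction k with
  | zero => intro g _ _ j hj; exact absurd hj (Nat.not_lt_zero j)
  | succ k ih =>
    intro g hg h
    simp only [isTimesDifferentiable_succ_iff] at h
    have hd : Differentiable ℝ g := differentiable_of_fwdDiff
      (continuous_of_measurable_of_fwdDiff hg fun s => (h s).1.continuous) fun s => (h s).1
    refine isTimesDifferentiable_succ_iff.2 ⟨hd, ih (measurable_deriv g) fun s => ?_⟩
    rw [← deriv_fwdDiff hd]
    exact (h s).2

theorem IsTimesDifferentiable.sub {k : ℕ} : ∀ {f g : ℝ → ℝ}, IsTimesDifferentiable k f →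
    IsTimesDifferentiable k g → IsTimesDifferentiable k (fun x => f x - g x) := by
  induction k with
  | zero => intro f g _ _ j hj; exact absurd hj (Nat.not_lt_zero j)
  | succ k ih =>
    intro f g hf hg
    rw [isTimesDifferentiable_succ_iff] at *
    refine ⟨hf.1.sub hg.1, ?_⟩
    rw [show deriv (fun x => f x - g x) = fun x => deriv f x - deriv g x from
      funext fun x => deriv_fun_sub (hf.1 x) (hg.1 x)]
    exact ih hf.2 hg.2

theorem IsTimesDifferentiable.comp_add_right {k : ℕ} {f : ℝ → ℝ} (hf : IsTimesDifferentiable k f)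
    (h : ℝ) : IsTimesDifferentiable k (fun x => f (x + h)) := by
  intro j hj
  rw [iteratedDeriv_comp_add_const]
  exact (hf j hj).comp (by fun_prop : Differentiable ℝ fun x : ℝ => x + h)

theorem isTimesDifferentiable_const (k : ℕ) (c : ℝ) :
    IsTimesDifferentiable k (fun _ : ℝ => c) := by
  intro j _
  have : iteratedDeriv j (fun _ : ℝ => c) = fun _ => if j = 0 then c else 0 :=
    funext fun x => iteratedDeriv_const
  rw [this]
  exact differentiable_const _

/-! ### Analyticity -/

/-- Bounds of the form `C * M ^ k * k!` on the derivatives of a smooth function near `c` make its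
Taylor series at `c` converge to it. -/
theorem analyticAt_of_abs_iteratedDeriv_le {g : ℝ → ℝ} (hg : ∀ k : ℕ, ContDiff ℝ k g) {c r C M : ℝ}
    (hr : 0 < r) (hM : 0 < M)
    (hbound : ∀ k : ℕ, ∀ x, |x - c| < r → |iteratedDeriv k g x| ≤ C * M ^ k * k.factorial) :
    AnalyticAt ℝ g c := by
  set ρ : NNReal := ⟨min r (1 / (2 * M)), by positivity⟩ with hρ
  have hρr : (ρ : ℝ) ≤ r := min_le_left _ _
  have hρM : M * (ρ : ℝ) ≤ 1 / 2 := by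
    have h1 : (ρ : ℝ) ≤ 1 / (2 * M) := min_le_right _ _
    calc M * (ρ : ℝ) ≤ M * (1 / (2 * M)) := by gcongr
      _ = 1 / 2 := by field_simp
  have hρ0 : 0 < (ρ : ℝ) := lt_min hr (by positivity)
  have hC : 0 ≤ C := by
    have := (abs_nonneg _).trans (hbound 0 c (by simpa using hr))
    simpa using this
  have hcoeff : ∀ k, |iteratedDeriv k g c / k.factorial| ≤ C * M ^ k := fun k => by
    rw [abs_div, Nat.abs_cast, div_le_iff₀ (by positivity)]
    exact hbound k c (by simpa using hr)
  have hgeom : ∀ k : ℕ, ∀ t : ℝ, 0 ≤ t → t ≤ ρ → C * M ^ k * t ^ k ≤ C * (1 / 2) ^ k := by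
    intro k t ht0 ht
    rw [mul_assoc, ← mul_pow]
    have : M * t ≤ 1 / 2 := le_trans (by gcongr) hρM
    gcongr
  refine ⟨FormalMultilinearSeries.ofScalars ℝ fun k => iteratedDeriv k g c / k.factorial, ρ, ?_, ?_,
    fun {y} hy => ?_⟩
  · refine FormalMultilinearSeries.le_radius_of_bound _ C fun k => ?_
    rw [FormalMultilinearSeries.ofScalars_norm, Real.norm_eq_abs]
    refine (mul_le_mul_of_nonneg_right (hcoeff k) (by positivity)).trans
      ((hgeom k ρ hρ0.le le_rfl).trans ?_)
    exact mul_le_of_le_one_right hC (pow_le_one₀ (by norm_num) (by norm_num))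
  · exact_mod_cast hρ0
  have hyρ : |y| < ρ := by
    rw [Metric.eball_coe, Metric.mem_ball, dist_zero_right] at hy
    exact hy
  have hterm : ∀ k : ℕ, (FormalMultilinearSeries.ofScalars ℝ
      (fun k => iteratedDeriv k g c / k.factorial) k fun _ => y) =
      iteratedDeriv k g c / k.factorial * y ^ k := fun k => by
    rw [FormalMultilinearSeries.ofScalars_apply_eq, smul_eq_mul]
  simp only [hterm]
  have hhalf : Summable fun k : ℕ => C * (1 / 2 : ℝ) ^ k :=
    (summable_geometric_of_lt_one (by norm_num) (by norm_num)).mul_left C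
  have hsummable : Summable fun k : ℕ => iteratedDeriv k g c / k.factorial * y ^ k := by
    refine Summable.of_norm_bounded hhalf fun k => ?_
    rw [Real.norm_eq_abs, abs_mul, abs_pow]
    exact (mul_le_mul_of_nonneg_right (hcoeff k) (by positivity)).trans
      (hgeom k |y| (abs_nonneg y) hyρ.le)
  rw [hsummable.hasSum_iff_tendsto_nat, ← tendsto_add_atTop_iff_nat 1,
    tendsto_iff_norm_sub_tendsto_zero]
  refine squeeze_zero (fun _ => norm_nonneg _) (fun k => ?_)
    ((hhalf.tendsto_atTop_zero).comp (tendsto_add_atTop_nat 1))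
  rw [Real.norm_eq_abs, abs_sub_comm]
  by_cases hy0 : y = 0
  · rw [Finset.sum_eq_single_of_mem 0 (by simp) fun j _ hj => by simp [hy0, hj]]
    simp only [hy0, add_zero, iteratedDeriv_zero, Nat.factorial_zero, Nat.cast_one, div_one,
      pow_zero, mul_one, sub_self, abs_zero, Function.comp_apply]
    positivity
  have hne : c ≠ c + y := fun h => hy0 (by linarith)
  obtain ⟨ξ, hξ, hT⟩ := taylor_mean_remainder_lagrange_iteratedDeriv (n := k) hne
    ((hg (k + 1)).contDiffOn.of_le (by simp))
  have hpoly : taylorWithinEval g k (Set.uIcc c (c + y)) c (c + y) =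
      ∑ i ∈ Finset.range (k + 1), iteratedDeriv i g c / i.factorial * y ^ i := by
    rw [taylor_within_apply]
    refine Finset.sum_congr rfl fun i _ => ?_
    rw [iteratedDerivWithin_eq_iteratedDeriv (uniqueDiffOn_uIcc hne) (hg i).contDiffAt
      Set.left_mem_uIcc, add_sub_cancel_left, smul_eq_mul]
    ring
  rw [hpoly, add_sub_cancel_left] at hT
  rw [hT, abs_div, abs_mul, abs_pow, Nat.abs_cast, div_le_iff₀ (by positivity)]
  have hξc : |ξ - c| < r := by
    refine lt_of_le_of_lt ?_ (hyρ.trans_le hρr)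
    have h1 : ξ ∈ Set.uIcc c (c + y) := Set.Ioo_subset_Icc_self hξ
    have := Set.abs_sub_left_of_mem_uIcc h1
    rwa [add_sub_cancel_left] at this
  calc |iteratedDeriv (k + 1) g ξ| * |y| ^ (k + 1)
      ≤ C * M ^ (k + 1) * (k + 1).factorial * |y| ^ (k + 1) := by
        gcongr; exact hbound _ _ hξc
    _ = C * M ^ (k + 1) * |y| ^ (k + 1) * (k + 1).factorial := by ring
    _ ≤ C * (1 / 2) ^ (k + 1) * (k + 1).factorial := by
        gcongr ?_ * _; exact hgeom _ _ (abs_nonneg y) hyρ.le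

/-- Baire's theorem bounds the numbers `g⁽ᵏ⁾(h) - g⁽ᵏ⁾(0)` by `M ^ (k + 1) * k!` uniformly for `h`
in an interval; the mean value theorem provides a point of the interval at which `g⁽ᵏ⁾` itself is
bounded. So `g` is analytic in this interval, hence everywhere. -/
theorem analyticOnNhd_of_fwdDiff {g : ℝ → ℝ} (hg : Measurable g)
    (h : ∀ h, AnalyticOnNhd ℝ (fwdDiff h g) Set.univ) : AnalyticOnNhd ℝ g Set.univ := by
  have hsmooth : ∀ k : ℕ, ContDiff ℝ k g := fun k =>
    contDiff_of_fwdDiff k hg fun s => (h s).contDiff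
  have hderiv : ∀ (k : ℕ) (s : ℝ), iteratedDeriv k (fwdDiff s g) 0 =
      iteratedDeriv k g s - iteratedDeriv k g 0 := fun k s => by
    change iteratedDeriv k (fun x => g (x + s) - g x) 0 = _
    have hs : ContDiff ℝ k fun x => g (x + s) := (hsmooth k).comp (by fun_prop)
    rw [iteratedDeriv_fun_sub hs.contDiffAt (hsmooth k).contDiffAt,
      iteratedDeriv_comp_add_const]
    simp only [zero_add]
  let S : ℕ → Set ℝ := fun m => {s | ∀ k : ℕ,
    |iteratedDeriv k g s - iteratedDeriv k g 0| ≤ ((m : ℝ) + 1) ^ (k + 1) * k.factorial}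
  have hclosed : ∀ m, IsClosed (S m) := fun m => by
    simp only [S, Set.ofPred_forall]
    refine isClosed_iInter fun k => isClosed_le ?_ continuous_const
    exact (((hsmooth k).continuous_iteratedDeriv k le_rfl).sub continuous_const).abs
  have hcover : ⋃ m, S m = Set.univ := by
    refine Set.eq_univ_of_forall fun s => ?_
    obtain ⟨ρ, hρ⟩ := (h s 0 (Set.mem_univ _)).hasFPowerSeriesAt
    obtain ⟨C, q, hC, hq, hCq⟩ :=
      FormalMultilinearSeries.le_mul_pow_of_radius_pos _ (hρ.r_pos.trans_le hρ.r_le)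
    refine Set.mem_iUnion.2 ⟨max ⌈C⌉₊ ⌈q⌉₊, fun k => ?_⟩
    have h1 := hCq k
    rw [FormalMultilinearSeries.ofScalars_norm, Real.norm_eq_abs, abs_div, Nat.abs_cast,
      div_le_iff₀ (by positivity), hderiv] at h1
    refine h1.trans ?_
    have hC' : C ≤ ((max ⌈C⌉₊ ⌈q⌉₊ : ℕ) : ℝ) + 1 :=
      (Nat.le_ceil C).trans ((Nat.cast_le.2 (le_max_left _ _)).trans (by linarith))
    have hq' : q ≤ ((max ⌈C⌉₊ ⌈q⌉₊ : ℕ) : ℝ) + 1 :=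
      (Nat.le_ceil q).trans ((Nat.cast_le.2 (le_max_right _ _)).trans (by linarith))
    rw [pow_succ']
    gcongr
  obtain ⟨m, c, hc⟩ := nonempty_interior_of_iUnion_of_closed hclosed hcover
  obtain ⟨r, hr, hball⟩ := Metric.isOpen_iff.1 isOpen_interior c hc
  have hS : ∀ x, |x - c| < r → x ∈ S m := fun x hx =>
    interior_subset (hball (by rwa [Metric.mem_ball, Real.dist_eq]))
  set M : ℝ := (m : ℝ) + 1 with hMdef
  have hM1 : 1 ≤ M := by rw [hMdef]; linarith [Nat.cast_nonneg (α := ℝ) m]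
  have hosc : ∀ k x y, |x - c| < r → |y - c| < r →
      |iteratedDeriv k g x - iteratedDeriv k g y| ≤ 2 * (M ^ (k + 1) * k.factorial) := by
    intro k x y hx hy
    have h1 := hS x hx k
    have h2 := hS y hy k
    have h3 := abs_sub (iteratedDeriv k g x - iteratedDeriv k g 0)
      (iteratedDeriv k g y - iteratedDeriv k g 0)
    rw [sub_sub_sub_cancel_right] at h3
    linarith
  have hcr : |c + r / 2 - c| < r := by
    rw [add_sub_cancel_left, abs_of_pos (by positivity)]; linarith
  have hc0 : |c - c| < r := by simpa using hr
  have hbound : ∀ k : ℕ, ∀ x, |x - c| < r → |iteratedDeriv k g x| ≤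
      (2 * M + 4 / r + |g c|) * M ^ k * k.factorial := by
    intro k x hx
    -- a point at which the derivative of order `k` is controlled
    obtain ⟨ξ, hξ, hξb⟩ : ∃ ξ, |ξ - c| < r ∧
        |iteratedDeriv k g ξ| ≤ (4 / r + |g c|) * M ^ k * k.factorial := by
      cases k with
      | zero =>
        refine ⟨c, hc0, ?_⟩
        simp only [iteratedDeriv_zero, pow_zero, mul_one, Nat.factorial_zero, Nat.cast_one]
        linarith [show (0 : ℝ) ≤ 4 / r by positivity]
      | succ k =>
        have hdiff : Differentiable ℝ (iteratedDeriv k g) :=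
          (hsmooth (k + 1)).differentiable_iteratedDeriv k (by exact_mod_cast Nat.lt_succ_self k)
        obtain ⟨ξ, hξ, hξd⟩ := exists_deriv_eq_slope (iteratedDeriv k g)
          (show c < c + r / 2 by linarith) hdiff.continuous.continuousOn hdiff.differentiableOn
        refine ⟨ξ, ?_, ?_⟩
        · rw [abs_of_pos (by linarith [hξ.1])]; linarith [hξ.2]
        · rw [iteratedDeriv_succ, hξd, abs_div, add_sub_cancel_left,
            abs_of_pos (show 0 < r / 2 by positivity), div_le_iff₀ (by positivity)]
          refine (hosc k _ _ hcr hc0).trans ?_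
          have hfac : (k.factorial : ℝ) ≤ (k + 1).factorial := by
            exact_mod_cast Nat.factorial_le (Nat.le_succ k)
          calc 2 * (M ^ (k + 1) * k.factorial) ≤ 2 * (M ^ (k + 1) * (k + 1).factorial) := by gcongr
            _ = (4 / r + 0) * M ^ (k + 1) * (k + 1).factorial * (r / 2) := by field_simp; ring
            _ ≤ (4 / r + |g c|) * M ^ (k + 1) * (k + 1).factorial * (r / 2) := by
              gcongr; exact abs_nonneg _
    have h1 := hosc k x ξ hx hξ
    have h2 := abs_add_le (iteratedDeriv k g x - iteratedDeriv k g ξ) (iteratedDeriv k g ξ)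
    rw [sub_add_cancel] at h2
    rw [pow_succ] at h1
    linarith
  have hgc : AnalyticAt ℝ g c :=
    analyticAt_of_abs_iteratedDeriv_le hsmooth hr (one_pos.trans_le hM1) hbound
  intro x _
  rw [eq_comp_fwdDiff g (x - c)]
  have hshift : AnalyticAt ℝ (fun y : ℝ => y + (-(x - c))) x := by fun_prop
  refine AnalyticAt.add (AnalyticAt.comp (g := g) ?_ hshift)
    (AnalyticAt.comp (g := fwdDiff (x - c) g) (h _ _ (Set.mem_univ _)) hshift)
  simpa using hgc

/-! ### Decomposition into a derivation and a regular part -/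

theorem iterScaleDiffAtOne_const_mul (n : ℕ) (c a : ℝ) :
    iterScaleDiffAtOne n (fun x => c * x) a = 0 := by
  have h1 : scaleDiff a (fun x => c * x) = fun _ => 0 := by
    funext x; simp only [scaleDiff]; ring
  have h2 : ∀ k, (scaleDiff a)^[k] (fun _ => 0) = fun _ => 0 := by
    intro k
    induction k with
    | zero => rfl
    | succ k ih =>
      rw [Function.iterate_succ_apply', ih]
      funext x; simp [scaleDiff]
  rw [iterScaleDiffAtOne, Function.iterate_succ_apply, h1, h2]

/-- The decomposition theorem for a class `X` of Riemann integrable functions that is closed under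
subtraction and translation, contains the constants, and contains each Riemann integrable function
all of whose differences lie in `X`. -/
theorem fwdDiff_mem_and_iff_hasDerivationDecomposition {X : (ℝ → ℝ) → Prop}
    (hsub : ∀ f g, X f → X g → X fun x => f x - g x) (hconst : ∀ c, X fun _ => c)
    (htrans : ∀ f h, X f → X fun x => f (x + h)) (hX : ∀ f, X f → BoundedAEContinuous f)
    (hdiff : ∀ g, BoundedAEContinuous g → (∀ h, X (fwdDiff h g)) → X g)
    {Reg : (ℝ → ℝ) → Prop} (n : ℕ)
    (hReg : ∀ D, Reg D → BoundedOnPosMeasureSet D)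
    (hXReg : ∀ g, X g → Reg (iterScaleDiffAtOne n g)) (f : ℝ → ℝ) :
    ((∀ h, X (fwdDiff h f)) ∧ Reg (iterScaleDiffAtOne n f)) ↔
      HasDerivationDecomposition n X f := by
  constructor
  · rintro ⟨hf, hD⟩
    obtain ⟨A, g, hg, hfg⟩ := exists_additive_add_boundedAEContinuous fun h => hX _ (hf h)
    have hXg : X g := hdiff g hg fun h => by
      have : fwdDiff h g = fun x => fwdDiff h f x - A h := by
        funext x; simp only [fwdDiff, hfg, map_add]; ring
      rw [this]
      exact hsub _ _ (hf h) (hconst _)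
    set d : ℝ →+ ℝ := A - AddMonoidHom.mulLeft (A 1) with hd
    have hdapp : ∀ x, d x = A x - A 1 * x := fun x => rfl
    have hfd : ∀ x, f x = d x + A 1 * x + g x := fun x => by rw [hfg, hdapp]; ring
    have hDd : iterScaleDiffAtOne n d =
        fun a => iterScaleDiffAtOne n f a - iterScaleDiffAtOne n g a := by
      funext a
      rw [funext hfd, iterScaleDiffAtOne_add n (fun x => d x + A 1 * x) g,
        iterScaleDiffAtOne_add n d fun x => A 1 * x, iterScaleDiffAtOne_const_mul]
      ring
    refine ⟨d, A 1, g, isDerivationOfOrder_of_boundedOnPosMeasureSet d (by simp [hdapp]) ?_, hXg,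
      hfd⟩
    rw [hDd]
    exact (hReg _ hD).sub_locallyBoundedFun (hg.bounded.iterScaleDiffAtOne n)
  · rintro ⟨d, lam, g, hd, hXg, hfd⟩
    refine ⟨fun h => ?_, ?_⟩
    · have : fwdDiff h f = fun x => (g (x + h) - g x) - (-(d h + lam * h)) := by
        funext x; simp only [fwdDiff, hfd, hd.map_add]; ring
      rw [this]
      exact hsub _ _ (hsub _ _ (htrans _ _ hXg) hXg) (hconst _)
    · have : iterScaleDiffAtOne n f = iterScaleDiffAtOne n g := by
        funext a
        rw [funext hfd, iterScaleDiffAtOne_add n (fun x => d x + lam * x) g,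
          iterScaleDiffAtOne_add n d fun x => lam * x, iterScaleDiffAtOne_const_mul,
          hd.iterScaleDiffAtOne_eq_zero]
        ring
      rw [this]
      exact hXReg g hXg

/-- The measure-theoretic condition on `𝐃f` holds for each locally bounded function and
implies boundedness on a set of positive measure. -/
theorem fwdDiff_mem_and_measure_condition_iff {X : (ℝ → ℝ) → Prop}
    (hsub : ∀ f g, X f → X g → X fun x => f x - g x) (hconst : ∀ c, X fun _ => c)
    (htrans : ∀ f h, X f → X fun x => f (x + h)) (hX : ∀ f, X f → BoundedAEContinuous f)
    (hdiff : ∀ g, BoundedAEContinuous g → (∀ h, X (fwdDiff h g)) → X g) (n : ℕ) (f : ℝ → ℝ) :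
    ((∀ h, X (fwdDiff h f)) ∧ (BoundedOnPosMeasureSet (iterScaleDiffAtOne n f) ∨
      MeasurableOnPosMeasureSet (iterScaleDiffAtOne n f))) ↔ HasDerivationDecomposition n X f :=
  fwdDiff_mem_and_iff_hasDerivationDecomposition
    (Reg := fun D => BoundedOnPosMeasureSet D ∨ MeasurableOnPosMeasureSet D)
    hsub hconst htrans hX hdiff n
    (fun _ h => h.elim id MeasurableOnPosMeasureSet.boundedOnPosMeasureSet)
    (fun g hg => Or.inl ((hX g hg).bounded.iterScaleDiffAtOne n).boundedOnPosMeasureSet) f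

/-- The decomposition theorem for a class `X` of continuous functions, with the condition that
`𝐃f` is continuous at some point. -/
theorem fwdDiff_mem_and_continuousAt_iff {X : (ℝ → ℝ) → Prop}
    (hsub : ∀ f g, X f → X g → X fun x => f x - g x) (hconst : ∀ c, X fun _ => c)
    (htrans : ∀ f h, X f → X fun x => f (x + h)) (hX : ∀ f, X f → Continuous f)
    (hdiff : ∀ g, Continuous g → (∀ h, X (fwdDiff h g)) → X g) (n : ℕ) (f : ℝ → ℝ) :
    ((∀ h, X (fwdDiff h f)) ∧ ∃ a, ContinuousAt (iterScaleDiffAtOne n f) a) ↔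
      HasDerivationDecomposition n X f :=
  fwdDiff_mem_and_iff_hasDerivationDecomposition (Reg := fun D => ∃ a, ContinuousAt D a)
    hsub hconst htrans (fun g hg => (hX g hg).boundedAEContinuous)
    (fun g hg h => hdiff g (hg.continuous_of_fwdDiff fun s => hX _ (h s)) h) n
    (fun _ ⟨_, ha⟩ => ha.boundedOnPosMeasureSet)
    (fun g hg => ⟨0, ((hX g hg).iterScaleDiffAtOne n).continuousAt⟩) f

theorem mainTheorem4 (n : ℕ) (hn : 1 ≤ n) (f : ℝ → ℝ) :
    -- `k` times continuously differentiable, `k ≥ 0`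
    (∀ k : ℕ,
      ((∀ h : ℝ, ContDiff ℝ k (fwdDiff h f)) ∧
          ∃ α : ℝ, ContinuousAt (iterScaleDiffAtOne n f) α) ↔
        HasDerivationDecomposition n (fun γ => ContDiff ℝ k γ) f) ∧
    -- `k` times differentiable, `k ≥ 1`
    (∀ k : ℕ, 1 ≤ k →
      (((∀ h : ℝ, IsTimesDifferentiable k (fwdDiff h f)) ∧
          ∃ α : ℝ, ContinuousAt (iterScaleDiffAtOne n f) α) ↔
        HasDerivationDecomposition n (IsTimesDifferentiable k) f)) ∧
    -- real analytic
    (((∀ h : ℝ, AnalyticOnNhd ℝ (fwdDiff h f) Set.univ) ∧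
          ∃ α : ℝ, ContinuousAt (iterScaleDiffAtOne n f) α) ↔
        HasDerivationDecomposition n (fun γ => AnalyticOnNhd ℝ γ Set.univ) f) ∧
    -- locally Riemann integrable
    (((∀ h : ℝ, LocallyRiemannIntegrable (fwdDiff h f)) ∧
          (BoundedOnPosMeasureSet (iterScaleDiffAtOne n f) ∨
            MeasurableOnPosMeasureSet (iterScaleDiffAtOne n f))) ↔
        HasDerivationDecomposition n LocallyRiemannIntegrable f) ∧
    -- locally absolutely continuous
    (((∀ h : ℝ, LocallyAbsolutelyContinuous (fwdDiff h f)) ∧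
          (BoundedOnPosMeasureSet (iterScaleDiffAtOne n f) ∨
            MeasurableOnPosMeasureSet (iterScaleDiffAtOne n f))) ↔
        HasDerivationDecomposition n LocallyAbsolutelyContinuous f) ∧
    -- locally of bounded variation
    (((∀ h : ℝ, LocallyBoundedVariationOn (fwdDiff h f) Set.univ) ∧
          (BoundedOnPosMeasureSet (iterScaleDiffAtOne n f) ∨
            MeasurableOnPosMeasureSet (iterScaleDiffAtOne n f))) ↔
        HasDerivationDecomposition n (fun γ => LocallyBoundedVariationOn γ Set.univ) f) := by
  refine ⟨fun k => ?_, fun k hk => ?_, ?_, ?_, ?_, ?_⟩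
  · exact fwdDiff_mem_and_continuousAt_iff (X := fun g => ContDiff ℝ k g)
      (fun _ _ hf hg => hf.sub hg) (fun _ => contDiff_const)
      (fun _ _ hf => hf.comp (by fun_prop)) (fun _ hf => hf.continuous)
      (fun _ hg h => contDiff_of_fwdDiff k hg.measurable h) n f
  · exact fwdDiff_mem_and_continuousAt_iff (fun _ _ hf hg => hf.sub hg)
      (isTimesDifferentiable_const k) (fun _ h hf => hf.comp_add_right h)
      (fun g hg => (show Differentiable ℝ g by simpa using hg 0 hk).continuous)
      (fun _ hg h => isTimesDifferentiable_of_fwdDiff k hg.measurable h) n f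
  · exact fwdDiff_mem_and_continuousAt_iff (X := fun g => AnalyticOnNhd ℝ g Set.univ)
      (fun _ _ hf hg => hf.sub hg) (fun _ => analyticOnNhd_const)
      (fun _ h hf => hf.comp (f := fun x : ℝ => x + h) (fun x _ => by fun_prop)
        (Set.mapsTo_univ _ _))
      (fun _ hf => continuousOn_univ.1 hf.continuousOn)
      (fun _ hg h => analyticOnNhd_of_fwdDiff hg.measurable h) n f
  · rw [show LocallyRiemannIntegrable = BoundedAEContinuous from
      funext fun _ => propext locallyRiemannIntegrable_iff_boundedAEContinuous]
    exact fwdDiff_mem_and_measure_condition_iff (fun _ _ hf hg => hf.sub hg)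
      (fun _ => continuous_const.boundedAEContinuous) (fun _ h hf => hf.comp_add_right h)
      (fun _ hf => hf) (fun _ hg _ => hg) n f
  · exact fwdDiff_mem_and_measure_condition_iff (fun _ _ hf hg => hf.sub hg)
      locallyAbsolutelyContinuous_const (fun _ h hf => hf.comp_add_right h)
      (fun _ hf => hf.continuous.boundedAEContinuous)
      (fun _ hg h => hg.locallyAbsolutelyContinuous_of_fwdDiff h) n f
  · exact fwdDiff_mem_and_measure_condition_iff
      (X := fun g => LocallyBoundedVariationOn g Set.univ)
      (fun _ _ hf hg => locallyBoundedVariationOn_univ_sub hf hg)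
      locallyBoundedVariationOn_univ_const
      (fun _ h hf => locallyBoundedVariationOn_univ_comp_add_right hf h)
      (fun _ hf => hf.boundedAEContinuous)
      (fun _ hg h => hg.locallyBoundedVariationOn_of_fwdDiff h) n f
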